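/- Let $p,q\ge 0$ be integers with $D=p+q\ge 2$, let $\eta=\mathrm{diag}(+1,\dots,+1,-1,\dots,-1)$ ($p$ plus signs, $q$ minus signs) be the metric of $\mathbb R^{p,q}$, let $k\in\mathbb R^{p,q}$ with $k^2=\eta_{mn}k^mk^n\neq 0$, and put $\omega=D-1$ and $\Theta^n_r=\delta^n_r-k_rk^n/k^2$. For vectors $a,b$ write $\Theta^{(a)}_{(b)}=a^r\,b_n\,\Theta^n_r$ with $b_n=\eta_{nm}b^m$, and $\Theta^{(a)}_{(\partial_b)}=a^r\,\Theta^n_r\,\partial/\partial b^n$. The Brauer algebra $\mathcal Br_j(\omega)$ is the unital associative $\mathbb C$-algebra with generators $\sigma_i,\kappa_i$ ($1\le i\le j-1$) and relations $\sigma_i^2=1$, $\kappa_i^2=\omega\kappa_i$, $\sigma_i\kappa_i=\kappa_i\sigma_i=\kappa_i$; $\sigma_i\sigma_l=\sigma_l\sigma_i$, $\kappa_i\kappa_l=\kappa_l\kappa_i$, $\sigma_i\kappa_l=\kappa_l\sigma_i$ for $|i-l|>1$; $\sigma_i\sigma_{i+1}\sigma_i=\sigma_{i+1}\sigma_i\sigma_{i+1}$,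 $\kappa_i\kappa_{i+1}\kappa_i=\kappa_i$, $\kappa_{i+1}\kappa_i\kappa_{i+1}=\kappa_{i+1}$, $\sigma_i\kappa_{i+1}\kappa_i=\sigma_{i+1}\kappa_i$, $\kappa_{i+1}\kappa_i\sigma_{i+1}=\kappa_{i+1}\sigma_i$. Put $\hat R_i(w)=\sigma_i\bigl(1-\frac{\sigma_i}{w}+\frac{\kappa_i}{w-\omega/2+1}\bigr)$ and define $\Xi_j\in\mathcal Br_j(\omega)$ by $\Xi_1=1$ and $\Xi_j=\Xi_{j-1}\,\hat R_{j-1}(-(j-1))\cdots\hat R_2(-2)\,\hat R_1(-1)$. Let $S_{(k)}$ be the (non-unital) homomorphism from $\mathcal Br_j(\omega)$ to the operators on the complexification of $(\mathbb R^{p,q})^{\otimes j}$ that sends $\sigma_i$ to the exchange of the tensor factors $i,i+1$ composed with $\Theta^{\otimes j}$, sends $\kappa_i$ to the operator with $\Theta^{n_in_{i+1}}\Theta_{r_ir_{i+1}}$ in the factors $i,i+1$ and $\Theta^n_r$ in all the others (indices moved with $\eta$), and sends $1$ to $\Theta^{\otimes j}$. For $j\ge1$ let $$\Xi^{(j)}(x,u)=\frac1{j!}\,u_{n_1}\cdots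 u_{n_j}\,(S_{(k)}(\Xi_j))^{n_1\dots n_j}_{r_1\dots r_j}\,x^{r_1}\cdots x^{r_j}.$$ Then for every $j\ge 2$ $$\Xi^{(j)}(x,u)=\frac1{(j-1)!}\Bigl(\Theta^{(x)}_{(u)}-\frac{1}{\omega+2(j-2)}\,\Theta^{(x)}_{(x)}\,(u\cdot\partial_x)\Bigr)\bigl(\Theta^{(x)}_{(\partial_z)}\bigr)^{j-1}\,\Xi^{(j-1)}(z,u),\qquad u\cdot\partial_x=u^r\frac{\partial}{\partial x^r}.$$ Moreover, for every $j\ge1$ the operator $\frac1{j!}S_{(k)}(\Xi_j)$ is the Behrends-Fronsdal projector $\Theta^{(j)}(k)$: it is idempotent and hermitian, symmetric, transverse to $k$ and traceless in its upper and in its lower indices, and its generating function is $$\Xi^{(j)}(x,u)=\sum_{A=0}^{[j/2]}a^{(j)}_A\,\bigl(\Theta^{(u)}_{(u)}\Theta^{(x)}_{(x)}\bigr)^A\bigl(\Theta^{(x)}_{(u)}\bigr)^{j-2A},\qquad a^{(j)}_A=\frac{(-1/2)^A\,j!}{(j-2A)!\,A!\,\prod_{s=1}^{A}(2j+D-2s-3)}.$$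 -/

import Mathlib

namespace BehrendsFronsdal

open Matrix

/-! ### The Brauer algebra -/

/-- The generators of the Brauer algebra on `j` strands. They are numbered from `0`:
`sigma r` and `kappa r` act on the strands `r` and `r + 1` (strands also counted from `0`). -/
inductive BrauerGen (j : ℕ) : Type
  | sigma (r : Fin (j - 1)) : BrauerGen j
  | kappa (r : Fin (j - 1)) : BrauerGen j

section Relations

variable {j : ℕ}

/-- The generator `σ_r` in the free algebra. -/
def fs (r : Fin (j - 1)) : FreeAlgebra ℂ (BrauerGen j) := FreeAlgebra.ι ℂ (BrauerGen.sigma r)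

/-- The generator `κ_r` in the free algebra. -/
def fk (r : Fin (j - 1)) : FreeAlgebra ℂ (BrauerGen j) := FreeAlgebra.ι ℂ (BrauerGen.kappa r)

/-- The defining relations of the Brauer algebra with parameter `ω`. -/
inductive BrauerRel (j : ℕ) (ω : ℂ) :
    FreeAlgebra ℂ (BrauerGen j) → FreeAlgebra ℂ (BrauerGen j) → Prop
  | sigma_sq (r) : BrauerRel j ω (fs r * fs r) 1
  | kappa_sq (r) : BrauerRel j ω (fk r * fk r) (ω • fk r)
  | sigma_kappa (r) : BrauerRel j ω (fs r * fk r) (fk r)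
  | kappa_sigma (r) : BrauerRel j ω (fk r * fs r) (fk r)
  | sigma_far (r s : Fin (j - 1)) (h : r.val + 1 < s.val ∨ s.val + 1 < r.val) :
      BrauerRel j ω (fs r * fs s) (fs s * fs r)
  | kappa_far (r s : Fin (j - 1)) (h : r.val + 1 < s.val ∨ s.val + 1 < r.val) :
      BrauerRel j ω (fk r * fk s) (fk s * fk r)
  | sigma_kappa_far (r s : Fin (j - 1)) (h : r.val + 1 < s.val ∨ s.val + 1 < r.val) :
      BrauerRel j ω (fs r * fk s) (fk s * fs r)
  | braid (r s : Fin (j - 1)) (h : r.val + 1 = s.val) :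
      BrauerRel j ω (fs r * fs s * fs r) (fs s * fs r * fs s)
  | kappa_up (r s : Fin (j - 1)) (h : r.val + 1 = s.val) :
      BrauerRel j ω (fk r * fk s * fk r) (fk r)
  | kappa_down (r s : Fin (j - 1)) (h : r.val + 1 = s.val) :
      BrauerRel j ω (fk s * fk r * fk s) (fk s)
  | mixed_left (r s : Fin (j - 1)) (h : r.val + 1 = s.val) :
      BrauerRel j ω (fs r * fk s * fk r) (fs s * fk r)
  | mixed_right (r s : Fin (j - 1)) (h : r.val + 1 = s.val) :
      BrauerRel j ω (fk s * fk r * fs s) (fk s * fs r)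

end Relations

/-- The Brauer algebra `Br_j(ω)` over `ℂ`. -/
abbrev BrauerAlgebra (j : ℕ) (ω : ℂ) : Type := RingQuot (BrauerRel j ω)

/-- The generator `σ_r` of `Br_j(ω)`. -/
noncomputable def sigma (j : ℕ) (ω : ℂ) (r : Fin (j - 1)) : BrauerAlgebra j ω :=
  RingQuot.mkAlgHom ℂ (BrauerRel j ω) (fs r)

/-- The generator `κ_r` of `Br_j(ω)`. -/
noncomputable def kappa (j : ℕ) (ω : ℂ) (r : Fin (j - 1)) : BrauerAlgebra j ω :=
  RingQuot.mkAlgHom ℂ (BrauerRel j ω) (fk r)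

/-- A generator of `Br_j(ω)`, seen in `Br_{j+1}(ω)`. -/
noncomputable def inclGen (j : ℕ) (ω : ℂ) : BrauerGen j → BrauerAlgebra (j + 1) ω
  | .sigma r => sigma (j + 1) ω (Fin.castLE (by omega) r)
  | .kappa r => kappa (j + 1) ω (Fin.castLE (by omega) r)

theorem inclGen_rel (j : ℕ) (ω : ℂ) ⦃a b : FreeAlgebra ℂ (BrauerGen j)⦄ (h : BrauerRel j ω a b) :
    FreeAlgebra.lift ℂ (inclGen j ω) a = FreeAlgebra.lift ℂ (inclGen j ω) b := by
  induction h <;>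
    simp only [fs, fk, map_mul, map_one, map_smul, FreeAlgebra.lift_ι_apply, inclGen, sigma, kappa]
  all_goals
    simp only [← map_mul, ← map_smul, ← map_one (RingQuot.mkAlgHom ℂ (BrauerRel (j + 1) ω))]
    apply RingQuot.mkAlgHom_rel ℂ
  · exact .sigma_sq _
  · exact .kappa_sq _
  · exact .sigma_kappa _
  · exact .kappa_sigma _
  · exact .sigma_far _ _ (by simpa)
  · exact .kappa_far _ _ (by simpa)
  · exact .sigma_kappa_far _ _ (by simpa)
  · exact .braid _ _ (by simpa)
  · exact .kappa_up _ _ (by simpa)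
  · exact .kappa_down _ _ (by simpa)
  · exact .mixed_left _ _ (by simpa)
  · exact .mixed_right _ _ (by simpa)

/-- The standard homomorphism `Br_j(ω) → Br_{j+1}(ω)`, `σ_r ↦ σ_r`, `κ_r ↦ κ_r`. -/
noncomputable def incl (j : ℕ) (ω : ℂ) : BrauerAlgebra j ω →ₐ[ℂ] BrauerAlgebra (j + 1) ω :=
  RingQuot.liftAlgHom ℂ ⟨FreeAlgebra.lift ℂ (inclGen j ω), inclGen_rel j ω⟩

/-- `R̂_r(w) = σ_r (1 - σ_r / w + κ_r / (w - ϰ))`, where `ϰ = ω / 2 - 1`. -/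
noncomputable def Rhat (j : ℕ) (ω : ℂ) (r : Fin (j - 1)) (w : ℂ) : BrauerAlgebra j ω :=
  sigma j ω r * (1 - (1 / w) • sigma j ω r + (1 / (w - (ω / 2 - 1))) • kappa j ω r)

/-- The element `Ξ_j` of `Br_j(ω)`: `Ξ_1 = 1` and, with the generators numbered from `1`,
`Ξ_{j+1} = Ξ_j · R̂_j(-j) ⋯ R̂_2(-2) R̂_1(-1)`. -/
noncomputable def Xi (ω : ℂ) : (j : ℕ) → BrauerAlgebra j ω
  | 0 => 1
  | j + 1 => incl j ω (Xi ω j) *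
      ((List.finRange j).reverse.map fun i : Fin j =>
        Rhat (j + 1) ω i (-((i.val : ℂ) + 1))).prod

/-! ### Tensor representations -/

/-- Operators on the `j`-th tensor power of the (complexified) `D`-dimensional space, as matrices:
the entry at `(n, r)` is `M^{n_1 … n_j}_{r_1 … r_j}`. -/
abbrev TMat (D j : ℕ) : Type := Matrix (Fin j → Fin D) (Fin j → Fin D) ℂ

/-- The operator that exchanges the tensor factors `r`, `s` and applies `θ` to every factor. -/
def permOp {D : ℕ} (j : ℕ) (θ : Matrix (Fin D) (Fin D) ℂ) (r s : Fin j) : TMat D j :=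
  fun l i => ∏ m, θ (l m) (i (Equiv.swap r s m))

/-- The operator `chk^{l_r l_s} hat_{i_r i_s}` in the tensor factors `r`, `s`, and `θ` in the
other factors. -/
def contrOp {D : ℕ} (j : ℕ) (θ hat chk : Matrix (Fin D) (Fin D) ℂ) (r s : Fin j) : TMat D j :=
  fun l i => chk (l r) (l s) * hat (i r) (i s) *
    ∏ m ∈ Finset.univ \ {r, s}, θ (l m) (i m)

/-- `θ ⊗ ⋯ ⊗ θ`. -/
def unitOp {D : ℕ} (j : ℕ) (θ : Matrix (Fin D) (Fin D) ℂ) : TMat D j :=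
  fun l i => ∏ m, θ (l m) (i m)

/-- The identities between the three matrices that are used to represent `Br_j(ω)`. -/
structure IsTriple {D : ℕ} (θ hat chk : Matrix (Fin D) (Fin D) ℂ) (ω : ℂ) : Prop where
  idem : θ * θ = θ
  chk_symm : chkᵀ = chk
  hat_symm : hatᵀ = hat
  chk_hat : chk * hat = θ
  th_chk : θ * chk = chk
  hat_th : hat * θ = hat
  tr : θ.trace = ω


/-! Auxiliary facts: the operators satisfy the relations of the Brauer algebra. -/

def kron {D j : ℕ} (B : Fin j → Matrix (Fin D) (Fin D) ℂ) : TMat D j :=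
  fun l i => ∏ m, B m (l m) (i m)

theorem kron_mul {D j : ℕ} (B C : Fin j → Matrix (Fin D) (Fin D) ℂ) :
    kron B * kron C = kron (fun m => B m * C m) := by
  ext l i
  simp only [kron, Matrix.mul_apply]
  rw [Fintype.prod_sum]
  simp only [Finset.prod_mul_distrib]

/-- One-site factors of `contrOp`. -/
def siteA {D : ℕ} (chk : Matrix (Fin D) (Fin D) ℂ) (a b : Fin D) : Matrix (Fin D) (Fin D) ℂ :=
  vecMulVec (fun x => chk x a) (Pi.single b 1)
def siteB {D : ℕ} (hat : Matrix (Fin D) (Fin D) ℂ) (a b : Fin D) : Matrix (Fin D) (Fin D) ℂ :=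
  vecMulVec (Pi.single a 1) (fun y => hat b y)

def site {D j : ℕ} (θ hat chk : Matrix (Fin D) (Fin D) ℂ) (r s : Fin j) (a b : Fin D) (m : Fin j) :
    Matrix (Fin D) (Fin D) ℂ :=
  if m = r then siteA chk a b else if m = s then siteB hat a b else θ

theorem prod_split2 {j : ℕ} {r s : Fin j} (h : r ≠ s) (f : Fin j → ℂ) :
    ∏ m, f m = f r * f s * ∏ m ∈ Finset.univ \ {r, s}, f m := by
  rw [← Finset.prod_sdiff (Finset.subset_univ {r, s}), Finset.prod_pair h, mul_comm]

theorem prod_split3 {j : ℕ} {r s t : Fin j} (h : r ≠ s) (h1 : r ≠ t) (h2 : s ≠ t) (f : Fin j → ℂ) :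
    ∏ m, f m = f r * f s * f t * ∏ m ∈ Finset.univ \ {r, s, t}, f m := by
  rw [← Finset.prod_sdiff (Finset.subset_univ {r, s, t}), Finset.prod_insert (by simp [h, h1]),
    Finset.prod_pair h2, mul_comm]; ring

theorem prod_split4 {j : ℕ} {r s t u : Fin j} (h : r ≠ s) (h1 : r ≠ t) (h2 : s ≠ t)
    (h3 : r ≠ u) (h4 : s ≠ u) (h5 : t ≠ u) (f : Fin j → ℂ) :
    ∏ m, f m = f r * f s * f t * f u * ∏ m ∈ Finset.univ \ {r, s, t, u}, f m := by
  rw [← Finset.prod_sdiff (Finset.subset_univ {r, s, t, u}),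
    Finset.prod_insert (by simp [h, h1, h3]), Finset.prod_insert (by simp [h2, h4]),
    Finset.prod_pair h5, mul_comm]; ring

theorem contrOp_eq {D j : ℕ} (θ hat chk : Matrix (Fin D) (Fin D) ℂ) {r s : Fin j} (h : r ≠ s) :
    contrOp j θ hat chk r s = ∑ a, ∑ b, kron (site θ hat chk r s a b) := by
  ext l i
  simp only [Matrix.sum_apply, kron, contrOp]
  simp only [prod_split2 h]
  have : ∀ a b, ∏ m ∈ Finset.univ \ {r, s}, site θ hat chk r s a b m (l m) (i m)
      = ∏ m ∈ Finset.univ \ {r, s}, θ (l m) (i m) := by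
    intro a b
    refine Finset.prod_congr rfl fun m hm => ?_
    simp at hm
    simp [site, hm]
  simp only [this, ← Finset.sum_mul]
  congr 1
  simp [site, h.symm, siteA, siteB, vecMulVec_apply, Pi.single_apply]

section
variable {D j : ℕ} {θ hat chk : Matrix (Fin D) (Fin D) ℂ} {ω : ℂ}

theorem th_siteA (H : IsTriple θ hat chk ω) (a b) : θ * siteA chk a b = siteA chk a b := by
  rw [siteA, mul_vecMulVec]; congr 1
  ext x; exact congrFun (congrFun H.th_chk x) a

theorem siteB_th (H : IsTriple θ hat chk ω) (a b) : siteB hat a b * θ = siteB hat a b := by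
  rw [siteB, vecMulVec_mul]; congr 1
  ext x; exact congrFun (congrFun H.hat_th b) x

theorem chk_th (H : IsTriple θ hat chk ω) : chk * θᵀ = chk := by
  have := congrArg transpose H.th_chk
  rwa [transpose_mul, H.chk_symm] at this

theorem th_hat (H : IsTriple θ hat chk ω) : θᵀ * hat = hat := by
  have := congrArg transpose H.hat_th
  rwa [transpose_mul, H.hat_symm] at this

theorem hat_chk (H : IsTriple θ hat chk ω) : hat * chk = θᵀ := by
  have := congrArg transpose H.chk_hat
  rwa [transpose_mul, H.hat_symm, H.chk_symm] at this

theorem siteAθ (H : IsTriple θ hat chk ω) (x y z w : Fin D) :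
    ∑ a, ∑ b, (siteA chk a b * θ) x y * siteB hat a b z w = chk x z * hat y w := by
  conv_rhs => rw [← th_hat H]
  simp [siteA, siteB, vecMulVec_apply, Pi.single_apply,
    Matrix.mul_apply, Finset.mul_sum, mul_assoc]

theorem siteBθ (H : IsTriple θ hat chk ω) (x y z w : Fin D) :
    ∑ a, ∑ b, siteA chk a b x y * (θ * siteB hat a b) z w = chk x z * hat y w := by
  conv_rhs => rw [← chk_th H]
  simp [siteA, siteB, vecMulVec_apply, Pi.single_apply,
    Matrix.mul_apply, Finset.sum_mul, mul_assoc]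

theorem unit_mul_contr (H : IsTriple θ hat chk ω) {r s : Fin j} (h : r ≠ s) :
    kron (fun _ => θ) * contrOp j θ hat chk r s = contrOp j θ hat chk r s := by
  rw [contrOp_eq _ _ _ h, Finset.mul_sum]
  simp only [Finset.mul_sum, kron_mul]
  rw [← contrOp_eq _ _ _ h]
  ext l i
  simp only [Matrix.sum_apply, kron, contrOp]
  simp only [prod_split2 h]
  have : ∀ a b, ∏ m ∈ Finset.univ \ {r, s}, (θ * site θ hat chk r s a b m) (l m) (i m)
      = ∏ m ∈ Finset.univ \ {r, s}, θ (l m) (i m) := by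
    intro a b
    refine Finset.prod_congr rfl fun m hm => ?_
    simp at hm
    simp [site, hm, H.idem]
  simp only [this, ← Finset.sum_mul]
  congr 1
  simp only [site, h.symm, if_true, if_false, th_siteA H]
  simp only [siteA, siteB, mul_vecMulVec, vecMulVec_apply, Pi.single_apply]
  have e := congrFun (congrFun (chk_th H) (l r)) (l s)
  rw [← e]
  simp [Matrix.mul_apply, Finset.sum_mul, mulVec, dotProduct, Pi.single_apply]
  refine Finset.sum_congr rfl fun a _ => by ring

theorem contr_mul_unit (H : IsTriple θ hat chk ω) {r s : Fin j} (h : r ≠ s) :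
    contrOp j θ hat chk r s * kron (fun _ => θ) = contrOp j θ hat chk r s := by
  rw [contrOp_eq _ _ _ h, Finset.sum_mul]
  simp only [Finset.sum_mul, kron_mul]
  rw [← contrOp_eq _ _ _ h]
  ext l i
  simp only [Matrix.sum_apply, kron, contrOp]
  simp only [prod_split2 h]
  have : ∀ a b, ∏ m ∈ Finset.univ \ {r, s}, (site θ hat chk r s a b m * θ) (l m) (i m)
      = ∏ m ∈ Finset.univ \ {r, s}, θ (l m) (i m) := by
    intro a b
    refine Finset.prod_congr rfl fun m hm => ?_
    simp at hm
    simp [site, hm, H.idem]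
  simp only [this, ← Finset.sum_mul]
  congr 1
  simp only [site, h.symm, if_true, if_false, siteB_th H]
  simp only [siteA, siteB, vecMulVec_mul, vecMulVec_apply, Pi.single_apply]
  have e := congrFun (congrFun (th_hat H) (i r)) (i s)
  rw [← e]
  simp [Matrix.mul_apply, Finset.mul_sum, vecMul, dotProduct, Pi.single_apply]
  refine Finset.sum_congr rfl fun a _ => by ring

theorem contr_sq (H : IsTriple θ hat chk ω) {r s : Fin j} (h : r ≠ s) :
    contrOp j θ hat chk r s * contrOp j θ hat chk r s = ω • contrOp j θ hat chk r s := by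
  have e1 : contrOp j θ hat chk r s * contrOp j θ hat chk r s =
      ∑ a, ∑ b, ∑ c, ∑ d, kron (fun m => site θ hat chk r s a b m * site θ hat chk r s c d m) := by
    conv_lhs => rw [contrOp_eq _ _ _ h]
    simp only [Finset.sum_mul]
    simp only [Finset.mul_sum, kron_mul]
  rw [e1]
  ext l i
  simp only [Matrix.sum_apply, kron, contrOp, Matrix.smul_apply, smul_eq_mul]
  simp only [prod_split2 h]
  have : ∀ a b c d, ∏ m ∈ Finset.univ \ {r, s},
      (site θ hat chk r s a b m * site θ hat chk r s c d m) (l m) (i m)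
      = ∏ m ∈ Finset.univ \ {r, s}, θ (l m) (i m) := by
    intro a b c d
    refine Finset.prod_congr rfl fun m hm => ?_
    simp at hm
    simp [site, hm, H.idem]
  simp only [this, ← Finset.sum_mul, ← mul_assoc]
  congr 1
  simp only [site, h.symm, if_true, if_false]
  simp only [siteA, siteB, vecMulVec_mul_vecMulVec, vecMulVec_apply, Pi.single_apply]
  rw [← H.tr, ← H.chk_hat]
  simp only [Matrix.trace, Matrix.diag_apply, Matrix.mul_apply, Finset.sum_mul]
  simp [Pi.single_apply]
  refine Finset.sum_congr rfl fun b _ => Finset.sum_congr rfl fun c _ => ?_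
  have e := congrFun (congrFun H.hat_symm b) c
  rw [transpose_apply] at e
  rw [e]; ring

theorem contr_symm (H : IsTriple θ hat chk ω) (r s : Fin j) :
    contrOp j θ hat chk r s = contrOp j θ hat chk s r := by
  ext l i
  simp only [contrOp]
  have e1 := congrFun (congrFun H.chk_symm (l r)) (l s)
  have e2 := congrFun (congrFun H.hat_symm (i r)) (i s)
  rw [transpose_apply] at e1 e2
  rw [e1, e2, Finset.pair_comm]

theorem contr_contr (H : IsTriple θ hat chk ω) {r s t : Fin j} (h : r ≠ s) (h1 : r ≠ t)
    (h2 : s ≠ t) :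
    contrOp j θ hat chk r s * contrOp j θ hat chk s t =
      (contrOp j θ hat chk r s).submatrix id (fun i => i ∘ Equiv.swap r t) := by
  have e1 : contrOp j θ hat chk r s * contrOp j θ hat chk s t =
      ∑ a, ∑ b, ∑ c, ∑ d, kron (fun m => site θ hat chk r s a b m * site θ hat chk s t c d m) := by
    rw [contrOp_eq _ _ _ h, contrOp_eq _ _ _ h2]
    simp only [Finset.sum_mul]
    simp only [Finset.mul_sum, kron_mul]
  rw [e1]
  ext l i
  simp only [submatrix_apply, id, contrOp]
  have e2 : ∏ m ∈ Finset.univ \ {r, s}, θ (l m) ((i ∘ Equiv.swap r t) m) =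
      θ (l t) (i r) * ∏ m ∈ Finset.univ \ {r, s, t}, θ (l m) (i m) := by
    rw [← Finset.mul_prod_erase _ _ (show t ∈ Finset.univ \ {r, s} by simp [h1.symm, h2.symm])]
    simp only [Function.comp, Equiv.swap_apply_right]
    congr 1
    refine Finset.prod_congr ?_ fun m hm => ?_
    · ext m; simp; tauto
    · simp at hm
      rw [Equiv.swap_apply_of_ne_of_ne hm.1 hm.2.2]
  rw [e2]
  simp only [Matrix.sum_apply, kron]
  simp only [prod_split3 h h1 h2]
  have : ∀ a b c d, ∏ m ∈ Finset.univ \ {r, s, t},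
      (site θ hat chk r s a b m * site θ hat chk s t c d m) (l m) (i m)
      = ∏ m ∈ Finset.univ \ {r, s, t}, θ (l m) (i m) := by
    intro a b c d
    refine Finset.prod_congr rfl fun m hm => ?_
    simp at hm
    simp [site, hm, H.idem]
  simp only [this, ← Finset.sum_mul, ← mul_assoc]
  congr 1
  simp only [site, h, h1, h2, h.symm, h1.symm, h2.symm, if_true, if_false, Function.comp,
    Equiv.swap_apply_left, Equiv.swap_apply_of_ne_of_ne h.symm h2]
  simp only [siteA, siteB, vecMulVec_mul, mul_vecMulVec,
    vecMulVec_apply, Pi.single_apply]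
  have e3 : θ (l t) (i r) = (θ * (hat * chk)ᵀ * θ) (l t) (i r) := by
    rw [hat_chk H, transpose_transpose, H.idem, H.idem]
  rw [e3]
  have e4 := congrFun (congrFun H.hat_symm (i s)) (i t)
  rw [transpose_apply] at e4
  simp [Matrix.mul_apply, Finset.sum_mul, Finset.mul_sum, mulVec, vecMul, dotProduct,
    vecMulVec_apply, Pi.single_apply]
  rw [e4]
  refine Finset.sum_congr rfl fun b _ => ?_
  refine Finset.sum_congr rfl fun c _ => Finset.sum_congr rfl fun d _ => by ring

theorem contr_comm (H : IsTriple θ hat chk ω) {r s t u : Fin j} (h : r ≠ s) (h1 : r ≠ t)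
    (h2 : s ≠ t) (h3 : r ≠ u) (h4 : s ≠ u) (h5 : t ≠ u) :
    contrOp j θ hat chk r s * contrOp j θ hat chk t u =
      contrOp j θ hat chk t u * contrOp j θ hat chk r s := by
  have e1 : contrOp j θ hat chk r s * contrOp j θ hat chk t u =
      ∑ a, ∑ b, ∑ c, ∑ d, kron (fun m => site θ hat chk r s a b m * site θ hat chk t u c d m) := by
    rw [contrOp_eq _ _ _ h, contrOp_eq _ _ _ h5]
    simp only [Finset.sum_mul]
    simp only [Finset.mul_sum, kron_mul]
  have e2 : contrOp j θ hat chk t u * contrOp j θ hat chk r s =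
      ∑ a, ∑ b, ∑ c, ∑ d, kron (fun m => site θ hat chk t u c d m * site θ hat chk r s a b m) := by
    rw [contrOp_eq _ _ _ h, contrOp_eq _ _ _ h5]
    simp only [Finset.mul_sum]
    simp only [Finset.sum_mul, kron_mul]
  rw [e1, e2]
  ext l i
  simp only [Matrix.sum_apply, kron]
  simp only [prod_split4 h h1 h2 h3 h4 h5]
  have q1 : ∀ a b c d, ∏ m ∈ Finset.univ \ {r, s, t, u},
      (site θ hat chk r s a b m * site θ hat chk t u c d m) (l m) (i m)
      = ∏ m ∈ Finset.univ \ {r, s, t, u}, θ (l m) (i m) := by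
    intro a b c d
    refine Finset.prod_congr rfl fun m hm => ?_
    simp at hm
    simp [site, hm, H.idem]
  have q2 : ∀ a b c d, ∏ m ∈ Finset.univ \ {r, s, t, u},
      (site θ hat chk t u c d m * site θ hat chk r s a b m) (l m) (i m)
      = ∏ m ∈ Finset.univ \ {r, s, t, u}, θ (l m) (i m) := by
    intro a b c d
    refine Finset.prod_congr rfl fun m hm => ?_
    simp at hm
    simp [site, hm, H.idem]
  simp only [q1, q2, ← Finset.sum_mul]
  refine congrArg (· * _) ?_
  simp only [site, h, h1, h2, h.symm, h1.symm, h2.symm, h3, h4, h5, h3.symm, h4.symm, h5.symm,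
    if_true, if_false, siteB_th H, th_siteA H]
  have L : ∀ f g f' g' : Fin D → Fin D → ℂ,
      ∑ a, ∑ b, ∑ c, ∑ d, f a b * g a b * f' c d * g' c d =
        (∑ a, ∑ b, f a b * g a b) * (∑ c, ∑ d, f' c d * g' c d) := by
    intro f g f' g'
    simp only [Finset.sum_mul]
    simp only [Finset.mul_sum, mul_assoc]
  rw [L (fun a b => (siteA chk a b * θ) (l r) (i r)) (fun a b => siteB hat a b (l s) (i s))
      (fun c d => siteA chk c d (l t) (i t)) (fun c d => (θ * siteB hat c d) (l u) (i u)),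
    L (fun a b => siteA chk a b (l r) (i r)) (fun a b => (θ * siteB hat a b) (l s) (i s))
      (fun c d => (siteA chk c d * θ) (l t) (i t)) (fun c d => siteB hat c d (l u) (i u))]
  simp only [siteAθ H, siteBθ H]

theorem kron_unit_submatrix (π : Equiv.Perm (Fin j)) (M : TMat D j) :
    (kron (fun _ => θ) : TMat D j).submatrix id (fun i => i ∘ π) * M =
      kron (fun _ => θ) * M.submatrix (fun i => i ∘ π.symm) id := by
  ext l i
  simp only [Matrix.mul_apply, submatrix_apply, id]
  refine Fintype.sum_equiv (Equiv.arrowCongr π.symm (Equiv.refl _)) _ _ fun h => ?_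
  have : (Equiv.arrowCongr π.symm (Equiv.refl (Fin D))) h = h ∘ π := by
    ext m; simp [Equiv.arrowCongr]
  rw [this]
  congr 2
  ext m; simp

theorem mul_kron_unit_submatrix (π : Equiv.Perm (Fin j)) (M : TMat D j) :
    M * (kron (fun _ => θ) : TMat D j).submatrix id (fun i => i ∘ π) =
      (M * kron (fun _ => θ)).submatrix id (fun i => i ∘ π) := by
  ext l i
  simp only [Matrix.mul_apply, submatrix_apply, id]

theorem permOp_eq (r s : Fin j) : permOp j θ r s =
    (kron (fun _ => θ) : TMat D j).submatrix id (fun i => i ∘ Equiv.swap r s) := by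
  ext l i
  simp [permOp, kron]

theorem contr_reindex (π : Equiv.Perm (Fin j)) (r s : Fin j) :
    (contrOp j θ hat chk r s).submatrix (fun i => i ∘ π) id =
      (contrOp j θ hat chk (π r) (π s)).submatrix id (fun i => i ∘ π.symm) := by
  ext l i
  simp only [contrOp, submatrix_apply, id, Function.comp, Equiv.symm_apply_apply]
  congr 1
  refine Finset.prod_equiv π (fun m => by simp) fun m _ => by simp

theorem unit_reindex (π : Equiv.Perm (Fin j)) :
    (kron (fun _ => θ) : TMat D j).submatrix (fun i => i ∘ π) id =
      (kron (fun _ => θ) : TMat D j).submatrix id (fun i => i ∘ π.symm) := by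
  ext l i
  simp only [kron, submatrix_apply, id, Function.comp]
  exact Fintype.prod_equiv π _ _ fun m => by simp

/-- The permutation of the tensor factors by `π`, composed with `θ` in every factor. -/
def dperm {D j : ℕ} (θ : Matrix (Fin D) (Fin D) ℂ) (π : Equiv.Perm (Fin j)) : TMat D j :=
  (kron (fun _ => θ) : TMat D j).submatrix id (fun i => i ∘ π)

theorem dperm_one : dperm θ (1 : Equiv.Perm (Fin j)) = kron (fun _ => θ) := by
  ext l i; rfl

theorem unit_sq (H : IsTriple θ hat chk ω) :
    (kron (fun _ => θ) : TMat D j) * kron (fun _ => θ) = kron (fun _ => θ) := by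
  rw [kron_mul]; simp only [H.idem]

theorem dperm_mul (H : IsTriple θ hat chk ω) (π ρ : Equiv.Perm (Fin j)) :
    dperm θ π * dperm θ ρ = dperm θ (ρ * π) := by
  have e : (dperm θ ρ : TMat D j).submatrix (fun i => i ∘ π.symm) id =
      ((kron (fun _ => θ) : TMat D j).submatrix (fun i => i ∘ π.symm) id).submatrix id
        (fun i => i ∘ ρ) := rfl
  conv_lhs => rw [dperm]
  rw [kron_unit_submatrix, e, unit_reindex, submatrix_submatrix]
  have e2 := mul_kron_unit_submatrix (θ := θ) (ρ * π) (kron (fun _ => θ) : TMat D j)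
  rw [unit_sq H] at e2
  exact e2

theorem dperm_contr (H : IsTriple θ hat chk ω) (π : Equiv.Perm (Fin j)) {r s : Fin j}
    (h : r ≠ s) :
    dperm θ π * contrOp j θ hat chk r s =
      contrOp j θ hat chk (π.symm r) (π.symm s) * dperm θ π := by
  rw [dperm, kron_unit_submatrix, contr_reindex, mul_kron_unit_submatrix,
    contr_mul_unit H (by simpa using h)]
  have : ∀ (A B : TMat D j) (f : (Fin j → Fin D) → (Fin j → Fin D)),
    A * B.submatrix id f = (A * B).submatrix id f := fun _ _ _ => rfl
  rw [this, unit_mul_contr H (by simpa using h)]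
  rfl

theorem contr_dperm (H : IsTriple θ hat chk ω) (π : Equiv.Perm (Fin j)) {r s : Fin j}
    (h : r ≠ s) : contrOp j θ hat chk r s * dperm θ π =
      (contrOp j θ hat chk r s).submatrix id (fun i => i ∘ π) := by
  rw [dperm, mul_kron_unit_submatrix, contr_mul_unit H h]

theorem contr_swap (H : IsTriple θ hat chk ω) {r s : Fin j} (h : r ≠ s) :
    contrOp j θ hat chk r s * dperm θ (Equiv.swap r s) = contrOp j θ hat chk r s := by
  rw [contr_dperm H _ h]
  ext l i
  have e2 := congrFun (congrFun H.hat_symm (i r)) (i s)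
  rw [transpose_apply] at e2
  simp only [contrOp, submatrix_apply, id, Function.comp, Equiv.swap_apply_left,
    Equiv.swap_apply_right, e2]
  congr 1
  refine Finset.prod_congr rfl fun m hm => ?_
  simp at hm
  rw [Equiv.swap_apply_of_ne_of_ne hm.1 hm.2]

theorem contr_contr' (H : IsTriple θ hat chk ω) {r s t : Fin j} (h : r ≠ s) (h1 : r ≠ t)
    (h2 : s ≠ t) :
    contrOp j θ hat chk r s * contrOp j θ hat chk s t =
      contrOp j θ hat chk r s * dperm θ (Equiv.swap r t) := by
  rw [contr_contr H h h1 h2, contr_dperm H _ h]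

theorem contr_three (H : IsTriple θ hat chk ω) {r s t : Fin j} (h : r ≠ s) (h1 : r ≠ t)
    (h2 : s ≠ t) :
    contrOp j θ hat chk r s * contrOp j θ hat chk s t * contrOp j θ hat chk r s =
      contrOp j θ hat chk r s := by
  rw [contr_contr' H h h1 h2, mul_assoc, dperm_contr H _ h]
  simp only [Equiv.symm_swap, Equiv.swap_apply_left, Equiv.swap_apply_of_ne_of_ne h.symm h2]
  rw [contr_symm H t s, ← mul_assoc, contr_contr' H h h1 h2, mul_assoc, dperm_mul H]
  simp only [Equiv.swap_mul_self, dperm_one, contr_mul_unit H h]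

theorem swap_contr (H : IsTriple θ hat chk ω) {r s : Fin j} (h : r ≠ s) :
    dperm θ (Equiv.swap r s) * contrOp j θ hat chk r s = contrOp j θ hat chk r s := by
  rw [dperm_contr H _ h]
  simp only [Equiv.symm_swap, Equiv.swap_apply_left, Equiv.swap_apply_right]
  rw [contr_symm H s r, contr_swap H h]

theorem swap_cycle {r s t : Fin j} (h : r ≠ s) (h1 : r ≠ t) (h2 : s ≠ t) :
    Equiv.swap s t * Equiv.swap r t = Equiv.swap r t * Equiv.swap r s := by
  ext m
  congr 1
  simp only [Equiv.Perm.mul_apply, Equiv.swap_apply_def]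
  split_ifs <;> simp_all

theorem swap_cycle' {r s t : Fin j} (h : r ≠ s) (h1 : r ≠ t) (h2 : s ≠ t) :
    Equiv.swap s t * Equiv.swap r t = Equiv.swap r s * Equiv.swap s t := by
  ext m
  congr 1
  simp only [Equiv.Perm.mul_apply, Equiv.swap_apply_def]
  split_ifs <;> simp_all

theorem swap_braid {r s t : Fin j} (h : r ≠ s) (h1 : r ≠ t) (h2 : s ≠ t) :
    Equiv.swap r s * (Equiv.swap s t * Equiv.swap r s) =
      Equiv.swap s t * (Equiv.swap r s * Equiv.swap s t) := by
  rw [← swap_cycle' h h1 h2, ← mul_assoc, ← swap_cycle' h h1 h2, mul_assoc, swap_cycle h h1 h2]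

/-- `σ₁ κ₂ κ₁ = σ₂ κ₁` -/
theorem mixed_left (H : IsTriple θ hat chk ω) {r s t : Fin j} (h : r ≠ s) (h1 : r ≠ t)
    (h2 : s ≠ t) :
    dperm θ (Equiv.swap r s) * contrOp j θ hat chk s t * contrOp j θ hat chk r s =
      dperm θ (Equiv.swap s t) * contrOp j θ hat chk r s := by
  rw [mul_assoc, contr_symm H s t, contr_symm H r s, contr_contr' H h2.symm h1.symm h.symm,
    ← mul_assoc, dperm_contr H _ h2.symm, contr_symm H s r, dperm_contr H _ h]
  simp only [Equiv.symm_swap, Equiv.swap_apply_left, Equiv.swap_apply_right,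
    Equiv.swap_apply_of_ne_of_ne h1.symm h2.symm, Equiv.swap_apply_of_ne_of_ne h h1]
  rw [mul_assoc, dperm_mul H, Equiv.swap_comm t r, ← swap_cycle h h1 h2, ← dperm_mul H,
    ← mul_assoc, contr_symm H t r, contr_swap H h1]

/-- `κ₂ κ₁ σ₂ = κ₂ σ₁` -/
theorem mixed_right (H : IsTriple θ hat chk ω) {r s t : Fin j} (h : r ≠ s) (h1 : r ≠ t)
    (h2 : s ≠ t) :
    contrOp j θ hat chk s t * contrOp j θ hat chk r s * dperm θ (Equiv.swap s t) =
      contrOp j θ hat chk s t * dperm θ (Equiv.swap r s) := by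
  rw [contr_symm H s t, contr_symm H r s, contr_contr' H h2.symm h1.symm h.symm, mul_assoc,
    dperm_mul H, Equiv.swap_comm t r, swap_cycle' h h1 h2, ← dperm_mul H, ← mul_assoc,
    contr_symm H t s, contr_swap H h2]

end
/-- The tensor factor on which the generator number `r` acts first. -/
def lo {j : ℕ} (r : Fin (j - 1)) : Fin j := ⟨r.val, by omega⟩

/-- The tensor factor on which the generator number `r` acts second. -/
def hi {j : ℕ} (r : Fin (j - 1)) : Fin j := ⟨r.val + 1, by omega⟩

/-- Images of the generators under an auxiliary unital homomorphism; it agrees on the range of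
`unitOp j θ` with the representation defined below. -/
def repGen {D : ℕ} (j : ℕ) (θ hat chk : Matrix (Fin D) (Fin D) ℂ) : BrauerGen j → TMat D j
  | .sigma r => permOp j θ (lo r) (hi r) + (1 - unitOp j θ)
  | .kappa r => contrOp j θ hat chk (lo r) (hi r)

section
variable {D j : ℕ} {θ hat chk : Matrix (Fin D) (Fin D) ℂ} {ω : ℂ}

theorem permOp_eq_dperm (r s : Fin j) : permOp j θ r s = dperm θ (Equiv.swap r s) := permOp_eq r s

theorem unitOp_eq_dperm : unitOp j θ = dperm θ (1 : Equiv.Perm (Fin j)) := rfl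

theorem unit_mul_contr' (H : IsTriple θ hat chk ω) {r s : Fin j} (h : r ≠ s) :
    unitOp j θ * contrOp j θ hat chk r s = contrOp j θ hat chk r s := unit_mul_contr H h

theorem contr_mul_unit' (H : IsTriple θ hat chk ω) {r s : Fin j} (h : r ≠ s) :
    contrOp j θ hat chk r s * unitOp j θ = contrOp j θ hat chk r s := contr_mul_unit H h

theorem unit_mul_dperm (H : IsTriple θ hat chk ω) (π : Equiv.Perm (Fin j)) :
    unitOp j θ * dperm θ π = dperm θ π := by
  rw [unitOp_eq_dperm, dperm_mul H, mul_one]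

theorem dperm_mul_unit (H : IsTriple θ hat chk ω) (π : Equiv.Perm (Fin j)) :
    dperm θ π * unitOp j θ = dperm θ π := by
  rw [unitOp_eq_dperm, dperm_mul H, one_mul]

theorem unitOp_sq (H : IsTriple θ hat chk ω) : unitOp j θ * unitOp j θ = unitOp j θ := unit_sq H

theorem shift_mul_contr (H : IsTriple θ hat chk ω) (π : Equiv.Perm (Fin j)) {r s : Fin j}
    (h : r ≠ s) : (dperm θ π + (1 - unitOp j θ)) * contrOp j θ hat chk r s =
      dperm θ π * contrOp j θ hat chk r s := by
  rw [add_mul, sub_mul, unit_mul_contr' H h, one_mul, sub_self, add_zero]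

theorem contr_mul_shift (H : IsTriple θ hat chk ω) (π : Equiv.Perm (Fin j)) {r s : Fin j}
    (h : r ≠ s) : contrOp j θ hat chk r s * (dperm θ π + (1 - unitOp j θ)) =
      contrOp j θ hat chk r s * dperm θ π := by
  rw [mul_add, mul_sub, contr_mul_unit' H h, mul_one, sub_self, add_zero]

theorem shift_mul_shift (H : IsTriple θ hat chk ω) (π ρ : Equiv.Perm (Fin j)) :
    (dperm θ π + (1 - unitOp j θ)) * (dperm θ ρ + (1 - unitOp j θ)) =
      dperm θ (ρ * π) + (1 - unitOp j θ) := by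
  simp only [add_mul, mul_add, sub_mul, mul_sub, unit_mul_dperm H, dperm_mul_unit H,
    unitOp_sq H, dperm_mul H, one_mul, mul_one]
  abel

theorem lo_ne_hi (r : Fin (j - 1)) : lo r ≠ hi r := by
  simp [lo, hi]

theorem hi_eq_lo {r s : Fin (j - 1)} (h : r.val + 1 = s.val) : lo s = hi r := by
  simp [lo, hi, h]

theorem lo_ne_hi' {r s : Fin (j - 1)} (h : r.val + 1 = s.val) : lo r ≠ hi s := by
  simp [lo, hi]; omega

theorem repGen_rel (H : IsTriple θ hat chk ω) ⦃a b : FreeAlgebra ℂ (BrauerGen j)⦄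
    (h : BrauerRel j ω a b) :
    FreeAlgebra.lift ℂ (repGen j θ hat chk) a = FreeAlgebra.lift ℂ (repGen j θ hat chk) b := by
  have far : ∀ r s : Fin (j - 1), (r.val + 1 < s.val ∨ s.val + 1 < r.val) →
      lo r ≠ lo s ∧ hi r ≠ lo s ∧ lo r ≠ hi s ∧ hi r ≠ hi s := by
    intro r s h
    simp only [lo, hi, ne_eq, Fin.mk.injEq]
    omega
  induction h <;>
    simp only [fs, fk, map_mul, map_one, map_smul, FreeAlgebra.lift_ι_apply, repGen,
      permOp_eq_dperm, shift_mul_shift H, Equiv.swap_mul_self,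
      shift_mul_contr H _ (lo_ne_hi _), contr_mul_shift H _ (lo_ne_hi _)]
  case sigma_sq r => rw [← unitOp_eq_dperm]; abel
  case kappa_sq r => exact contr_sq H (lo_ne_hi r)
  case sigma_kappa r => exact swap_contr H (lo_ne_hi r)
  case kappa_sigma r => exact contr_swap H (lo_ne_hi r)
  case sigma_far r s h =>
    obtain ⟨h1, h2, h3, h4⟩ := far r s h
    have : Equiv.swap (lo s) (hi s) * Equiv.swap (lo r) (hi r) =
        Equiv.swap (lo r) (hi r) * Equiv.swap (lo s) (hi s) := by
      ext m
      congr 1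
      have h5 := lo_ne_hi r
      have h6 := lo_ne_hi s
      clear far
      generalize lo r = a at *
      generalize hi r = b at *
      generalize lo s = c at *
      generalize hi s = d at *
      simp only [Equiv.Perm.mul_apply, Equiv.swap_apply_def]
      split_ifs <;> simp_all
    rw [this]
  case kappa_far r s h =>
    obtain ⟨h1, h2, h3, h4⟩ := far r s h
    exact contr_comm H (lo_ne_hi r) h1 h2 h3 h4 (lo_ne_hi s)
  case sigma_kappa_far r s h =>
    obtain ⟨h1, h2, h3, h4⟩ := far r s h
    rw [dperm_contr H _ (lo_ne_hi s), Equiv.symm_swap,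
      Equiv.swap_apply_of_ne_of_ne h1.symm h2.symm, Equiv.swap_apply_of_ne_of_ne h3.symm h4.symm]
  case braid r s h =>
    have h1 := lo_ne_hi r
    have h2 := lo_ne_hi' h
    have h3 := lo_ne_hi s
    rw [hi_eq_lo h] at h3 ⊢
    rw [swap_braid h1 h2 h3]
  case kappa_up r s h =>
    rw [hi_eq_lo h]
    exact contr_three H (lo_ne_hi r) (lo_ne_hi' h) (hi_eq_lo h ▸ lo_ne_hi s)
  case kappa_down r s h =>
    rw [hi_eq_lo h, contr_symm H (hi r), contr_symm H (lo r)]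
    exact contr_three H (hi_eq_lo h ▸ lo_ne_hi s).symm (lo_ne_hi' h).symm (lo_ne_hi r).symm
  case mixed_left r s h =>
    rw [hi_eq_lo h]
    exact BehrendsFronsdal.mixed_left H (lo_ne_hi r) (lo_ne_hi' h) (hi_eq_lo h ▸ lo_ne_hi s)
  case mixed_right r s h =>
    rw [mul_assoc, contr_mul_shift H _ (lo_ne_hi r), hi_eq_lo h, ← mul_assoc]
    exact BehrendsFronsdal.mixed_right H (lo_ne_hi r) (lo_ne_hi' h) (hi_eq_lo h ▸ lo_ne_hi s)

/-- The auxiliary unital homomorphism with the values `repGen` on the generators. -/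
noncomputable def repAux (j : ℕ) (H : IsTriple θ hat chk ω) : BrauerAlgebra j ω →ₐ[ℂ] TMat D j :=
  RingQuot.liftAlgHom ℂ ⟨FreeAlgebra.lift ℂ (repGen j θ hat chk), repGen_rel H⟩

theorem repAux_sigma (H : IsTriple θ hat chk ω) (r : Fin (j - 1)) :
    repAux j H (sigma j ω r) = permOp j θ (lo r) (hi r) + (1 - unitOp j θ) := by
  rw [repAux, sigma, RingQuot.liftAlgHom_mkAlgHom_apply, fs, FreeAlgebra.lift_ι_apply, repGen]

theorem repAux_kappa (H : IsTriple θ hat chk ω) (r : Fin (j - 1)) :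
    repAux j H (kappa j ω r) = contrOp j θ hat chk (lo r) (hi r) := by
  rw [repAux, kappa, RingQuot.liftAlgHom_mkAlgHom_apply, fk, FreeAlgebra.lift_ι_apply, repGen]

theorem repAux_comm (H : IsTriple θ hat chk ω) (a : BrauerAlgebra j ω) :
    unitOp j θ * repAux j H a = repAux j H a * unitOp j θ := by
  obtain ⟨x, rfl⟩ := RingQuot.mkAlgHom_surjective ℂ (BrauerRel j ω) a
  rw [repAux, RingQuot.liftAlgHom_mkAlgHom_apply]
  induction x using FreeAlgebra.induction with
  | grade0 c => simp [Algebra.commutes]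
  | grade1 g =>
    rw [FreeAlgebra.lift_ι_apply]
    cases g with
    | sigma r =>
      simp only [repGen, permOp_eq_dperm, mul_add, add_mul, mul_sub, sub_mul, unit_mul_dperm H,
        dperm_mul_unit H, mul_one, one_mul]
    | kappa r =>
      simp only [repGen, unit_mul_contr' H (lo_ne_hi r), contr_mul_unit' H (lo_ne_hi r)]
  | mul x y hx hy => rw [map_mul, ← mul_assoc, hx, mul_assoc, hy, mul_assoc]
  | add x y hx hy => rw [map_add, mul_add, hx, hy, add_mul]

/-- The representation of `Br_j(ω)` attached to the matrices `θ`, `hat`, `chk`. It sends `σ_r` to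
`permOp`, `κ_r` to `contrOp`, and the unit of `Br_j(ω)` to `θ ⊗ ⋯ ⊗ θ`, as `σ_r² = 1` demands
(`rep_sigma`, `rep_kappa`, `rep_one`). -/
noncomputable def rep (j : ℕ) (H : IsTriple θ hat chk ω) :
    BrauerAlgebra j ω →ₙₐ[ℂ] TMat D j where
  toFun a := unitOp j θ * repAux j H a
  map_smul' c a := by simp
  map_zero' := by simp
  map_add' a b := by rw [map_add, mul_add]
  map_mul' a b := by
    rw [map_mul, mul_assoc, ← mul_assoc (repAux j H a), ← repAux_comm H a, mul_assoc,
      ← mul_assoc (unitOp j θ) (unitOp j θ), unitOp_sq H]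

theorem rep_one (H : IsTriple θ hat chk ω) : rep j H 1 = unitOp j θ := by
  change unitOp j θ * repAux j H 1 = _
  rw [map_one, mul_one]

theorem rep_sigma (H : IsTriple θ hat chk ω) (r : Fin (j - 1)) :
    rep j H (sigma j ω r) = permOp j θ (lo r) (hi r) := by
  change unitOp j θ * repAux j H _ = _
  rw [repAux_sigma, mul_add, mul_sub, unitOp_sq H, mul_one, sub_self, add_zero, permOp_eq_dperm,
    unit_mul_dperm H]

theorem rep_kappa (H : IsTriple θ hat chk ω) (r : Fin (j - 1)) :
    rep j H (kappa j ω r) = contrOp j θ hat chk (lo r) (hi r) := by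
  change unitOp j θ * repAux j H _ = _
  rw [repAux_kappa, unit_mul_contr' H (lo_ne_hi r)]

end

/-! ### The representation given by a momentum vector -/

/-- The diagonal entries `+1` (`p` times), `-1` (`q` times) of the metric of `ℝ^{p,q}`. -/
def eta (p q : ℕ) (i : Fin (p + q)) : ℝ := if i.val < p then 1 else -1

/-- `k² = η_{mn} k^m k^n`. -/
def normSq (p q : ℕ) (k : Fin (p + q) → ℝ) : ℝ := ∑ i, eta p q i * k i ^ 2

/-- `Θ^n_r = δ^n_r - k_r k^n / k²`; the upper index is the row index. -/
noncomputable def Theta (p q : ℕ) (k : Fin (p + q) → ℝ) :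
    Matrix (Fin (p + q)) (Fin (p + q)) ℂ :=
  fun n r => (((if n = r then 1 else 0) - (eta p q r * k r) * k n / normSq p q k : ℝ) : ℂ)

/-- `Θ_{mn} = Θ^l_m η_{ln}`. -/
noncomputable def ThetaLow (p q : ℕ) (k : Fin (p + q) → ℝ) :
    Matrix (Fin (p + q)) (Fin (p + q)) ℂ :=
  fun m n => Theta p q k n m * (eta p q n : ℂ)

/-- `Θ^{nm} = Θ^n_l η^{lm}`. -/
noncomputable def ThetaUp (p q : ℕ) (k : Fin (p + q) → ℝ) :
    Matrix (Fin (p + q)) (Fin (p + q)) ℂ :=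
  fun n m => Theta p q k n m * (eta p q m : ℂ)

/-- The parameter `ω = D - 1`, where `D = p + q`. -/
noncomputable def omega (p q : ℕ) : ℂ := ((p + q : ℕ) : ℂ) - 1

theorem eta_mul_self (p q : ℕ) (i : Fin (p + q)) : eta p q i * eta p q i = 1 := by
  unfold eta; split_ifs <;> norm_num

theorem eta_mul_self' (p q : ℕ) (i : Fin (p + q)) : (eta p q i : ℂ) * (eta p q i : ℂ) = 1 := by
  exact_mod_cast eta_mul_self p q i

theorem eta_Theta (p q : ℕ) (k : Fin (p + q) → ℝ) (n r : Fin (p + q)) :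
    (eta p q n : ℂ) * Theta p q k n r = Theta p q k r n * (eta p q r : ℂ) := by
  simp only [Theta]
  norm_cast
  by_cases h : n = r
  · subst h; ring
  · rw [if_neg h, if_neg (Ne.symm h)]; ring

theorem Theta_idem (p q : ℕ) {k : Fin (p + q) → ℝ} (hk : normSq p q k ≠ 0) :
    Theta p q k * Theta p q k = Theta p q k := by
  ext n r
  simp only [Matrix.mul_apply, Theta]
  simp only [← Complex.ofReal_mul, ← Complex.ofReal_sum]
  congr 1
  have e : ∀ m, ((if n = m then (1 : ℝ) else 0) - (eta p q m * k m) * k n / normSq p q k) *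
      ((if m = r then (1 : ℝ) else 0) - (eta p q r * k r) * k m / normSq p q k) =
      (if n = m then ((if n = r then (1 : ℝ) else 0) - (eta p q r * k r) * k n / normSq p q k)
        else 0) - (if m = r then (eta p q r * k r) * k n / normSq p q k else 0)
      + (eta p q r * k r) * k n / normSq p q k / normSq p q k * (eta p q m * k m ^ 2) := by
    intro m
    by_cases h : n = m <;> by_cases h' : m = r <;> [subst h h'; subst h; subst h'; skip] <;>
      simp [*] <;> ring
  rw [Finset.sum_congr rfl fun m _ => e m]
  rw [Finset.sum_add_distrib, Finset.sum_sub_distrib, ← Finset.mul_sum, ← normSq]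
  simp
  field_simp
  ring

theorem isTriple_Theta (p q : ℕ) {k : Fin (p + q) → ℝ} (hk : normSq p q k ≠ 0) :
    IsTriple (Theta p q k) (ThetaLow p q k) (ThetaUp p q k) (omega p q) := by
  have I := Theta_idem p q hk
  have I' : ∀ n r, ∑ m, Theta p q k n m * Theta p q k m r = Theta p q k n r := fun n r => by
    rw [← Matrix.mul_apply, I]
  have T := eta_Theta p q k
  have Q := eta_mul_self' p q
  refine ⟨I, ?_, ?_, ?_, ?_, ?_, ?_⟩
  · ext n m
    simp only [transpose_apply, ThetaUp]
    linear_combination (eta p q n : ℂ) * (eta p q m : ℂ) * T m n -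
      (eta p q n : ℂ) * Theta p q k m n * Q m + (eta p q m : ℂ) * Theta p q k n m * Q n
  · ext n m
    simp only [transpose_apply, ThetaLow]
    rw [mul_comm, T]
  · ext n r
    simp only [Matrix.mul_apply, ThetaUp, ThetaLow]
    rw [← I' n r]
    refine Finset.sum_congr rfl fun m _ => ?_
    rw [← T m r]
    linear_combination Theta p q k n m * Theta p q k m r * Q m
  · ext n m
    simp only [Matrix.mul_apply, ThetaUp, ← mul_assoc, ← Finset.sum_mul, I']
  · ext m r
    simp only [Matrix.mul_apply, ThetaLow]
    rw [← I' r m, Finset.sum_mul]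
    refine Finset.sum_congr rfl fun n _ => ?_
    linear_combination Theta p q k n m * T n r
  · simp only [Matrix.trace, Matrix.diag_apply, Theta, omega]
    rw [← Complex.ofReal_sum, Finset.sum_sub_distrib, ← Finset.sum_div]
    have : ∑ i, eta p q i * k i * k i = normSq p q k :=
      Finset.sum_congr rfl fun i _ => by ring
    rw [this, div_self hk]
    simp

/-- The representation `S_(k)` of `Br_j(D - 1)`, `D = p + q`, for a vector `k` with `k² ≠ 0`. -/
noncomputable def S (p q : ℕ) {k : Fin (p + q) → ℝ} (hk : normSq p q k ≠ 0) (j : ℕ) :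
    BrauerAlgebra j (omega p q) →ₙₐ[ℂ] TMat (p + q) j :=
  rep j (isTriple_Theta p q hk)

/-! ### Generating functions -/

/-- The names of the three auxiliary vectors. -/
inductive Letter : Type
  | x | z | u

/-- Polynomials in the components `x^r`, `z^r`, `u^r` of three vectors. -/
abbrev Poly (D : ℕ) : Type := MvPolynomial (Letter × Fin D) ℂ

/-- The components of the vector with the given name. -/
noncomputable def vec {D : ℕ} (a : Letter) (r : Fin D) : Poly D := MvPolynomial.X (a, r)

/-- `Θ^(a)_(b) = a^r b_n Θ^n_r`, where `b_n = η_{nm} b^m`. -/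
noncomputable def form (p q : ℕ) (k : Fin (p + q) → ℝ) (a b : Letter) : Poly (p + q) :=
  ∑ r, ∑ n, (eta p q n : ℂ) • (Theta p q k n r • (vec a r * vec b n))

/-- `Θ^(a)_(∂_b) = a^r Θ^n_r ∂/∂b^n`. -/
noncomputable def formD (p q : ℕ) (k : Fin (p + q) → ℝ) (a b : Letter) :
    Module.End ℂ (Poly (p + q)) :=
  ∑ r, ∑ n, Theta p q k n r •
    (LinearMap.mulLeft ℂ (vec a r) ∘ₗ (MvPolynomial.pderiv (b, n)).toLinearMap)

/-- `a · ∂_b = a^r ∂/∂b^r`. -/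
noncomputable def dirD {D : ℕ} (a b : Letter) : Module.End ℂ (Poly D) :=
  ∑ r, LinearMap.mulLeft ℂ (vec a r) ∘ₗ (MvPolynomial.pderiv (b, r)).toLinearMap

/-- The generating function `u_{n_1} ⋯ u_{n_j} M^{n_1 … n_j}_{r_1 … r_j} x^{r_1} ⋯ x^{r_j}` of an
operator `M`, in the vectors named `a` (in the place of `x`) and `b` (in the place of `u`). -/
noncomputable def genFun (p q : ℕ) {j : ℕ} (M : TMat (p + q) j) (a b : Letter) : Poly (p + q) :=
  ∑ n : Fin j → Fin (p + q), ∑ r : Fin j → Fin (p + q),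
    M n r • ((∏ i, (eta p q (n i) : ℂ) • vec b (n i)) * ∏ i, vec a (r i))

/-- The operator `S_(k)(Ξ_j) / j!`. -/
noncomputable def XiOp (p q : ℕ) {k : Fin (p + q) → ℝ} (hk : normSq p q k ≠ 0) (j : ℕ) :
    TMat (p + q) j :=
  (1 / (j.factorial : ℂ)) • S p q hk j (Xi (omega p q) j)

/-! ### The Behrends-Fronsdal projector -/

/-- The coefficient
`a^(j)_A = (-1/2)^A j! / ((j - 2A)! A! (2j + D - 5)(2j + D - 7) ⋯ (2j + D - 2A - 3))`. -/
noncomputable def bfCoeff (D j A : ℕ) : ℂ :=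
  (-1 / 2) ^ A * (j.factorial : ℂ) / (((j - 2 * A).factorial : ℂ) * (A.factorial : ℂ) *
    ∏ s ∈ Finset.Icc 1 A, (2 * (j : ℂ) + (D : ℂ) - 2 * (s : ℂ) - 3))

/-- `M` is the Behrends-Fronsdal projector of rank `j` for the momentum `k`: it is a hermitian
projector, symmetric, transverse and traceless in the upper and in the lower indices, and its
generating function is the one of Behrends and Fronsdal. (Symmetry and the generating function
determine `M`.) -/
structure IsBFProjector (p q : ℕ) (k : Fin (p + q) → ℝ) (j : ℕ) (M : TMat (p + q) j) : Prop where
  idem : M * M = M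
  hermitian : ∀ n r, M n r =
    (∏ i, (eta p q (n i) : ℂ)) * (∏ i, (eta p q (r i) : ℂ)) * star (M r n)
  symm_low : ∀ (s t : Fin j) n r, M n (r ∘ Equiv.swap s t) = M n r
  symm_up : ∀ (s t : Fin j) n r, M (n ∘ Equiv.swap s t) r = M n r
  transverse_low : ∀ (s : Fin j) n r, ∑ a, (k a : ℂ) * M n (Function.update r s a) = 0
  transverse_up : ∀ (s : Fin j) n r,
    ∑ a, (eta p q a : ℂ) * (k a : ℂ) * M (Function.update n s a) r = 0
  traceless_low : ∀ (s t : Fin j), s ≠ t → ∀ n r,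
    ∑ a, (eta p q a : ℂ) * M n (Function.update (Function.update r s a) t a) = 0
  traceless_up : ∀ (s t : Fin j), s ≠ t → ∀ n r,
    ∑ a, (eta p q a : ℂ) * M (Function.update (Function.update n s a) t a) r = 0
  genFun_eq : genFun p q M .x .u = ∑ A ∈ Finset.range (j / 2 + 1),
    bfCoeff (p + q) j A • ((form p q k .u .u * form p q k .x .x) ^ A * form p q k .x .u ^ (j - 2 * A))

end BehrendsFronsdal

open BehrendsFronsdal

/-! Let Y be the image of Ξ_j in Br_{j+1}, acting on the first j tensor factors and as Θ on the
last, the spectator. Suppose Y is symmetric and traceless in its j inputs, in the sense of absorbing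
permutations on the right and being killed on the right by contractions. Multiplying Y by R̂_j(-j) ⋯
R̂_1(-1) then produces only two kinds of terms: E_m (`moved`), where input m feeds the spectator,
and F_ab (`capped`), where inputs a and b are contracted with each other and the output of the
spectator is joined to an input of Y. The products E·σ, E·κ, F·σ, F·κ stay in their span, and the
coefficients can be tracked explicitly (`partialValue_step`). The result (`IsStrandRep.map_Xi_succ`)
is Ξ_{j+1} = Σ_m E_m - (1/(ω+2(j-1))) Σ_{a≠b} F_ab.

This sum is visibly invariant under permutations of the inputs. The rightmost factor R̂_1(-1) is
annihilated by κ_1, and by symmetry all other contractions vanish too. Hence Ξ_{j+1} is again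
symmetric and traceless on the right, and the induction closes (`IsStrandRep.rightTraceless`).

Conversely, on an operator M symmetric and traceless on the left, R̂_i(-i) acts as 1 + 1/i, so Ξ_j M
= j! M (`IsStrandRep.map_Xi_mul`). The generators are hermitian, so for X = S(Ξ_j) the adjoint X† is
symmetric and traceless on the left and X X† = j! X†. The left side is hermitian, hence X = X† and
X² = j! X. No identity for Ξ_j read backwards is needed, and the properties of the upper indices
follow from those of the lower ones.

In generating functions all inputs equal x, so each E_m gives Θ^(x)_(u) Ξ^(j), while for fixed b the
F_ab with a ≠ b add up, by the product rule, to Θ^(x)_(x) (u·∂_x) Ξ^(j). This is the recursion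
(`genFun_S_succ`, `genFun_XiOp_succ`). The power of Θ^(x)_(∂_z) in the theorem only substitutes x
for z, with a factorial. The closed form follows by induction from the recursion satisfied by the
coefficients (`bfCoeff'_succ`). -/

namespace BehrendsFronsdal

open Matrix

/-! ### Symmetric traceless operators on some of the tensor factors -/

section RightTraceless
variable {D N : ℕ} {θ hat chk : Matrix (Fin D) (Fin D) ℂ} {ω : ℂ}

/-- `Y` absorbs on the right the permutations of the tensor factors in `A`, and is annihilated on
the right by the contractions of two factors in `A`. -/
structure RightTraceless (θ hat chk : Matrix (Fin D) (Fin D) ℂ) (A : Set (Fin N))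
    (Y : TMat D N) : Prop where
  perm : ∀ τ : Equiv.Perm (Fin N), (∀ x, x ∉ A → τ x = x) → Y * dperm θ τ = Y
  contr : ∀ a ∈ A, ∀ b ∈ A, a ≠ b → Y * contrOp N θ hat chk a b = 0

/-- `Y` followed by the exchange of the factors `m` and `L`. -/
noncomputable def moved (θ : Matrix (Fin D) (Fin D) ℂ) (Y : TMat D N) (L m : Fin N) : TMat D N :=
  Y * dperm θ (Equiv.swap m L)

/-- `moved` followed by the contraction of the factors `a` and `b`. -/
noncomputable def capped (θ hat chk : Matrix (Fin D) (Fin D) ℂ) (Y : TMat D N) (L a b : Fin N) :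
    TMat D N :=
  moved θ Y L a * contrOp N θ hat chk a b

variable {A : Set (Fin N)} {Y : TMat D N} {L : Fin N}

theorem RightTraceless.unit (hY : RightTraceless θ hat chk A Y) : Y * unitOp N θ = Y :=
  hY.perm 1 fun _ _ => rfl

theorem moved_unit (H : IsTriple θ hat chk ω) (m : Fin N) :
    moved θ Y L m * unitOp N θ = moved θ Y L m := by
  rw [moved, mul_assoc, dperm_mul_unit H]

theorem capped_unit (H : IsTriple θ hat chk ω) {a b : Fin N} (h : a ≠ b) :
    capped θ hat chk Y L a b * unitOp N θ = capped θ hat chk Y L a b := by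
  rw [capped, mul_assoc, contr_mul_unit' H h]

theorem moved_self (hY : RightTraceless θ hat chk A Y) : moved θ Y L L = Y := by
  rw [moved, Equiv.swap_self]
  exact hY.perm 1 fun _ _ => rfl

theorem perm_mem_of_fixed {B : Set (Fin N)} {τ : Equiv.Perm (Fin N)} (h : ∀ x, x ∉ B → τ x = x)
    {m : Fin N} (hm : m ∈ B) : τ m ∈ B := by
  by_contra hc
  exact hc ((τ.injective (h _ hc)).symm ▸ hm)

/-- The terms `moved` correspond to the cosets of the permutations of A in those of A ∪ {L}: since Y
absorbs the former, only the input that feeds the factor L matters. -/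
theorem moved_dperm (H : IsTriple θ hat chk ω) (hY : RightTraceless θ hat chk A Y)
    {τ : Equiv.Perm (Fin N)} (hτ : ∀ x, x ∉ insert L A → τ x = x) {m : Fin N}
    (hm : m ∈ insert L A) : moved θ Y L m * dperm θ τ = moved θ Y L (τ m) := by
  -- This permutation fixes L, so Y absorbs it. `dperm` reverses products, which explains the order
  -- of the factors.
  have h1 : Y * dperm θ ((Equiv.swap (τ m) L)⁻¹ * (τ * Equiv.swap m L)) = Y := by
    refine hY.perm _ fun x hx => ?_
    simp only [Equiv.Perm.mul_apply, Equiv.swap_inv]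
    by_cases hL : x = L
    · subst hL; simp
    · have hxB : x ∉ insert L A := by simp [hL, hx]
      have e1 : x ≠ m := fun h => hxB (h ▸ hm)
      have e2 : x ≠ τ m := fun h => hxB (h ▸ perm_mem_of_fixed hτ hm)
      rw [Equiv.swap_apply_of_ne_of_ne e1 hL, hτ x hxB, Equiv.swap_apply_of_ne_of_ne e2 hL]
  rw [moved, mul_assoc, dperm_mul H, moved]
  conv_rhs => rw [← h1, mul_assoc, dperm_mul H, mul_inv_cancel_left]

theorem contr_mul_dperm (H : IsTriple θ hat chk ω) (τ : Equiv.Perm (Fin N)) {a b : Fin N}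
    (h : a ≠ b) : contrOp N θ hat chk a b * dperm θ τ =
      dperm θ τ * contrOp N θ hat chk (τ a) (τ b) := by
  rw [dperm_contr H τ (τ.injective.ne h), Equiv.symm_apply_apply, Equiv.symm_apply_apply]

theorem capped_dperm (H : IsTriple θ hat chk ω) (hY : RightTraceless θ hat chk A Y)
    {τ : Equiv.Perm (Fin N)} (hτ : ∀ x, x ∉ insert L A → τ x = x) {a b : Fin N}
    (ha : a ∈ insert L A) (h : a ≠ b) :
    capped θ hat chk Y L a b * dperm θ τ = capped θ hat chk Y L (τ a) (τ b) := by
  rw [capped, mul_assoc, contr_mul_dperm H τ h, ← mul_assoc, moved_dperm H hY hτ ha, capped]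

theorem swap_fixed {B : Set (Fin N)} {a b : Fin N} (ha : a ∈ B) (hb : b ∈ B) (x : Fin N)
    (hx : x ∉ B) : Equiv.swap a b x = x :=
  Equiv.swap_apply_of_ne_of_ne (fun h => hx (h ▸ ha)) (fun h => hx (h ▸ hb))

/-- A contraction absorbs the exchange of its two factors on the left, and that exchange turns
`moved` at a into `moved` at b. -/
theorem capped_symm (H : IsTriple θ hat chk ω) (hY : RightTraceless θ hat chk A Y)
    {a b : Fin N} (ha : a ∈ insert L A) (hb : b ∈ insert L A) (h : a ≠ b) :
    capped θ hat chk Y L a b = capped θ hat chk Y L b a := by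
  rw [capped, ← swap_contr H h, ← mul_assoc, moved_dperm H hY (swap_fixed ha hb) ha,
    Equiv.swap_apply_left, contr_symm H, capped]

/-- If m feeds the factor L, then a and b both feed inputs of Y, whose trace vanishes. -/
theorem moved_contr_zero (H : IsTriple θ hat chk ω) (hY : RightTraceless θ hat chk A Y)
    {m a b : Fin N} (hm : m ∈ insert L A) (ha : a ∈ insert L A) (hb : b ∈ insert L A)
    (h : a ≠ b) (hma : m ≠ a) (hmb : m ≠ b) :
    moved θ Y L m * contrOp N θ hat chk a b = 0 := by
  have key : ∀ x ∈ insert L A, m ≠ x → Equiv.swap m L x ∈ A := by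
    intro x hx hmx
    by_cases hL : x = L
    · subst hL
      rw [Equiv.swap_apply_right]
      exact hm.resolve_left hmx
    · rw [Equiv.swap_apply_of_ne_of_ne hmx.symm hL]
      exact hx.resolve_left hL
  rw [moved, mul_assoc, dperm_contr H _ h, ← mul_assoc, Equiv.symm_swap,
    hY.contr _ (key a ha hma) _ (key b hb hmb) ((Equiv.injective _).ne h), zero_mul]

/-- After the contraction of a and b, contracting b with c has the same effect as exchanging a and c
(`contr_contr'`). -/
theorem capped_contr_adjacent (H : IsTriple θ hat chk ω) (hY : RightTraceless θ hat chk A Y)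
    {a b c : Fin N} (ha : a ∈ insert L A) (hc : c ∈ insert L A)
    (h : a ≠ b) (h1 : a ≠ c) (h2 : b ≠ c) :
    capped θ hat chk Y L a b * contrOp N θ hat chk b c = capped θ hat chk Y L c b := by
  have e : capped θ hat chk Y L a b * contrOp N θ hat chk b c =
      capped θ hat chk Y L a b * dperm θ (Equiv.swap a c) := by
    rw [capped, mul_assoc, contr_contr' H h h1 h2, ← mul_assoc]
  rw [e, capped_dperm H hY (swap_fixed ha hc) ha h, Equiv.swap_apply_left,
    Equiv.swap_apply_of_ne_of_ne h.symm h2]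

theorem capped_contr_far (H : IsTriple θ hat chk ω) (hY : RightTraceless θ hat chk A Y)
    {a b c d : Fin N} (ha : a ∈ insert L A) (hc : c ∈ insert L A) (hd : d ∈ insert L A)
    (h : a ≠ b) (h1 : a ≠ c) (h2 : b ≠ c) (h3 : a ≠ d) (h4 : b ≠ d) (h5 : c ≠ d) :
    capped θ hat chk Y L a b * contrOp N θ hat chk c d = 0 := by
  rw [capped, mul_assoc, contr_comm H h h1 h2 h3 h4 h5, ← mul_assoc,
    moved_contr_zero H hY ha hc hd h5 h1 h3, zero_mul]

end RightTraceless

/-! ### Products of `R̂` -/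

/-- Invariant principle for a product with decreasing indices: the state r records that the factors
with index at least r have been multiplied on. -/
theorem reverse_prod_induction {M : Type*} [Monoid M] {j : ℕ} (f : Fin j → M)
    (P : Fin (j + 1) → M → Prop) (a : M) (h0 : P (Fin.last j) a)
    (hs : ∀ (i : Fin j) (b : M), P i.succ b → P i.castSucc (b * f i)) :
    P 0 (a * ((List.finRange j).reverse.map f).prod) := by
  induction j with
  | zero => simpa using h0
  | succ j ih =>
    -- After the reversal, the factor with index 0 is the rightmost one.
    rw [List.finRange_succ, List.reverse_cons, List.map_append, List.prod_append, ← mul_assoc,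
      List.map_singleton, List.prod_singleton]
    refine hs 0 _ ?_
    rw [← List.map_reverse, List.map_map]
    exact ih (f ∘ Fin.succ) (fun r => P r.succ) h0 fun i b hb => by
      rw [Fin.succ_castSucc]; exact hs i.succ b hb

/-- `φ` represents the generators of `Br_j(ω)` on the tensor factors with numbers `e 0, e 1, …`. -/
structure IsStrandRep {D N j : ℕ} (θ hat chk : Matrix (Fin D) (Fin D) ℂ) {ω : ℂ}
    (φ : BrauerAlgebra j ω →ₙₐ[ℂ] TMat D N) (e : Fin j → Fin N) : Prop where
  inj : Function.Injective e
  one : φ 1 = unitOp N θ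
  sigma : ∀ r, φ (sigma j ω r) = dperm θ (Equiv.swap (e (lo r)) (e (hi r)))
  kappa : ∀ r, φ (kappa j ω r) = contrOp N θ hat chk (e (lo r)) (e (hi r))

theorem incl_sigma (j : ℕ) (ω : ℂ) (r : Fin (j - 1)) :
    incl j ω (sigma j ω r) = sigma (j + 1) ω (Fin.castLE (by omega) r) := by
  rw [incl, sigma, RingQuot.liftAlgHom_mkAlgHom_apply, fs, FreeAlgebra.lift_ι_apply, inclGen]

theorem incl_kappa (j : ℕ) (ω : ℂ) (r : Fin (j - 1)) :
    incl j ω (kappa j ω r) = kappa (j + 1) ω (Fin.castLE (by omega) r) := by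
  rw [incl, kappa, RingQuot.liftAlgHom_mkAlgHom_apply, fk, FreeAlgebra.lift_ι_apply, inclGen]

/-! ### Representations of the Brauer algebra on selected tensor factors -/

section StrandRep
variable {D N j : ℕ} {θ hat chk : Matrix (Fin D) (Fin D) ℂ} {ω : ℂ}

/-- This is what selected factors are for: Br_j inside Br_{j+1} acts on the same N factors through
fewer strands, so induction on j can keep N fixed. -/
theorem IsStrandRep.comp_incl {φ : BrauerAlgebra (j + 1) ω →ₙₐ[ℂ] TMat D N}
    {e : Fin (j + 1) → Fin N} (hφ : IsStrandRep θ hat chk φ e) :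
    IsStrandRep θ hat chk (φ.comp (incl j ω : BrauerAlgebra j ω →ₙₐ[ℂ] BrauerAlgebra (j + 1) ω))
      (e ∘ Fin.castSucc) where
  inj := hφ.inj.comp (Fin.castSucc_injective j)
  one := by
    change φ (incl j ω 1) = _
    rw [map_one, hφ.one]
  sigma r := by
    change φ (incl j ω _) = _
    rw [incl_sigma, hφ.sigma]; rfl
  kappa r := by
    change φ (incl j ω _) = _
    rw [incl_kappa, hφ.kappa]; rfl

theorem isStrandRep_rep (H : IsTriple θ hat chk ω) : IsStrandRep θ hat chk (rep j H) id where
  inj := Function.injective_id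
  one := rep_one H
  sigma r := rep_sigma H r
  kappa r := rep_kappa H r

/-- With w = -(i+1), the denominator w - ω/2 + 1 is -(ω+2i)/2, and σ² = 1, σκ = κ remove the outer
σ. -/
theorem IsStrandRep.map_Rhat (H : IsTriple θ hat chk ω)
    {φ : BrauerAlgebra (j + 1) ω →ₙₐ[ℂ] TMat D N}
    {e : Fin (j + 1) → Fin N} (hφ : IsStrandRep θ hat chk φ e) (i : Fin j) :
    φ (Rhat (j + 1) ω i (-((i.val : ℂ) + 1))) =
      dperm θ (Equiv.swap (e i.castSucc) (e i.succ)) + (1 / ((i.val : ℂ) + 1)) • unitOp N θ -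
        (2 / (ω + 2 * (i.val : ℂ))) • contrOp N θ hat chk (e i.castSucc) (e i.succ) := by
  have hne : e i.castSucc ≠ e i.succ := hφ.inj.ne i.castSucc_lt_succ.ne
  have hs : φ (BehrendsFronsdal.sigma (j + 1) ω i) =
    dperm θ (Equiv.swap (e i.castSucc) (e i.succ)) := hφ.sigma i
  have hk : φ (BehrendsFronsdal.kappa (j + 1) ω i) =
    contrOp N θ hat chk (e i.castSucc) (e i.succ) := hφ.kappa i
  have c2 : 1 / (-((i.val : ℂ) + 1) - (ω / 2 - 1)) = -(2 / (ω + 2 * (i.val : ℂ))) := by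
    have : -((i.val : ℂ) + 1) - (ω / 2 - 1) = -((ω + 2 * (i.val : ℂ)) / 2) := by ring
    rw [this, one_div, inv_neg, inv_div]
  rw [Rhat, mul_add, mul_sub, mul_one, mul_smul_comm, mul_smul_comm, map_add, map_sub, map_smul,
    map_smul, map_mul, map_mul, hs, hk, dperm_mul H, Equiv.swap_mul_self, ← unitOp_eq_dperm,
    swap_contr H hne, c2, one_div, one_div, inv_neg]
  simp only [neg_smul, sub_neg_eq_add]
  rw [← sub_eq_add_neg]

end StrandRep

/-! ### Evaluation of Ξ_{j+1} and its symmetry and trace properties -/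

section Product
variable {D N j : ℕ} {θ hat chk : Matrix (Fin D) (Fin D) ℂ} {ω : ℂ}

theorem Ioi_castSucc_eq (i : Fin j) :
    Finset.Ioi i.castSucc = insert i.succ (Finset.Ioi i.succ) := by
  ext m
  simp only [Finset.mem_Ioi, Finset.mem_insert, Fin.lt_def, Fin.ext_iff, Fin.val_castSucc,
    Fin.val_succ]
  omega

theorem sum_Ioi_castSucc {M : Type*} [AddCommMonoid M] (i : Fin j) (f : Fin (j + 1) → M) :
    ∑ m ∈ Finset.Ioi i.castSucc, f m = f i.succ + ∑ m ∈ Finset.Ioi i.succ, f m := by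
  rw [Ioi_castSucc_eq, Finset.sum_insert (by simp)]

/-- The partial products give sums over a < b; permutation invariance is visible only on ordered
pairs a ≠ b. -/
theorem sum_sum_ne {M : Type*} [AddCommMonoid M] {n : ℕ} (f : Fin n → Fin n → M)
    (h : ∀ a b, a ≠ b → f a b = f b a) :
    ∑ b, ∑ a ∈ Finset.univ.erase b, f a b = 2 • ∑ a, ∑ b ∈ Finset.Ioi a, f a b := by
  have e : ∀ b : Fin n, ∑ a ∈ Finset.univ.erase b, f a b =
      ∑ a ∈ Finset.Ioi b, f b a + ∑ a ∈ Finset.Iio b, f a b := by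
    intro b
    have : Finset.univ.erase b = Finset.Ioi b ∪ Finset.Iio b := by
      ext a; simp [lt_or_lt_iff_ne, eq_comm]
    rw [this, Finset.sum_union (by
      rw [Finset.disjoint_left]; intro a; simp only [Finset.mem_Ioi, Finset.mem_Iio]
      exact fun h => h.asymm)]
    exact congrArg (· + _) (Finset.sum_congr rfl fun a ha => h a b (Finset.mem_Ioi.1 ha).ne')
  rw [Finset.sum_congr rfl fun b _ => e b, Finset.sum_add_distrib, two_nsmul]
  congr 1
  exact Finset.sum_comm' (by simp)

/-- The value of a partial product `Ξ_j R̂_j(-j) ⋯ R̂_{r+1}(-r-1)` (the first number being `1`). -/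
noncomputable def partialValue (θ hat chk : Matrix (Fin D) (Fin D) ℂ) (ω : ℂ)
    (e : Fin (j + 1) → Fin N) (Y : TMat D N) (r : Fin (j + 1)) : TMat D N :=
  let E := fun m => moved θ Y (e (Fin.last j)) (e m)
  let F := fun a b => capped θ hat chk Y (e (Fin.last j)) (e a) (e b)
  (1 / ((r.val : ℂ) + 1)) • ∑ m ∈ Finset.Ioi r, E m + E r -
    (2 / (ω + 2 * ((j : ℂ) - 1))) • (∑ b ∈ Finset.Ioi r, F r b +
      (1 / ((r.val : ℂ) + 1)) • ∑ a ∈ Finset.Ioi r, ∑ b ∈ Finset.Ioi a, F a b)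

theorem range_insert_last (e : Fin (j + 1) → Fin N) (m : Fin (j + 1)) :
    e m ∈ insert (e (Fin.last j)) (Set.range (e ∘ Fin.castSucc)) := by
  induction m using Fin.lastCases with
  | last => exact Or.inl rfl
  | cast i => exact Or.inr ⟨i, rfl⟩

theorem insert_last_eq (e : Fin (j + 1) → Fin N) :
    insert (e (Fin.last j)) (Set.range (e ∘ Fin.castSucc)) = Set.range e := by
  ext x
  constructor
  · rintro (rfl | ⟨i, rfl⟩) <;> exact ⟨_, rfl⟩
  · rintro ⟨m, rfl⟩; exact range_insert_last e m

/-- The exchange moves E_{i+1} to E_i and F_{i+1,b} to F_{i,b}, and fixes the terms with larger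
indices. The contraction kills everything except E_{i+1} and the F_{i+1,b}, all of which become
F_{i,i+1}. Two identities then carry the coefficients: (1/(i+2))(1 + 1/(i+1)) = 1/(i+1), and 1 -
2(j-1-i)/(ω+2(j-1)) = (ω+2i)/(ω+2(j-1)), whose numerator cancels the denominator of R̂. -/
theorem partialValue_step (H : IsTriple θ hat chk ω) (hω : ∀ m : ℕ, ω + 2 * (m : ℂ) ≠ 0)
    {e : Fin (j + 1) → Fin N} (he : Function.Injective e) {Y : TMat D N}
    (hY : RightTraceless θ hat chk (Set.range (e ∘ Fin.castSucc)) Y) (i : Fin j) :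
    partialValue θ hat chk ω e Y i.succ *
      (dperm θ (Equiv.swap (e i.castSucc) (e i.succ)) + (1 / ((i.val : ℂ) + 1)) • unitOp N θ -
        (2 / (ω + 2 * (i.val : ℂ))) • contrOp N θ hat chk (e i.castSucc) (e i.succ)) =
      partialValue θ hat chk ω e Y i.castSucc := by
  have hB := range_insert_last e
  have hlt := i.castSucc_lt_succ
  have hne : e i.castSucc ≠ e i.succ := he.ne hlt.ne
  have ne1 : ∀ m ∈ Finset.Ioi i.succ, e m ≠ e i.succ := fun m hm =>
    he.ne (Finset.mem_Ioi.1 hm).ne'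
  have ne0 : ∀ m ∈ Finset.Ioi i.succ, e m ≠ e i.castSucc := fun m hm =>
    he.ne (hlt.trans (Finset.mem_Ioi.1 hm)).ne'
  have fix := swap_fixed (hB i.castSucc) (hB i.succ)
  unfold partialValue
  extract_lets E F
  have hF : F i.castSucc i.succ = F i.succ i.castSucc :=
    capped_symm H hY (hB _) (hB _) hne
  -- the action of the exchange
  have s1 : (∑ m ∈ Finset.Ioi i.succ, E m) * dperm θ (Equiv.swap (e i.castSucc) (e i.succ)) =
      ∑ m ∈ Finset.Ioi i.succ, E m := by
    rw [Finset.sum_mul]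
    refine Finset.sum_congr rfl fun m hm => ?_
    rw [moved_dperm H hY fix (hB m), Equiv.swap_apply_of_ne_of_ne (ne0 m hm) (ne1 m hm)]
  have s2 : E i.succ * dperm θ (Equiv.swap (e i.castSucc) (e i.succ)) = E i.castSucc := by
    rw [moved_dperm H hY fix (hB _), Equiv.swap_apply_right]
  have s3 : (∑ b ∈ Finset.Ioi i.succ, F i.succ b) *
      dperm θ (Equiv.swap (e i.castSucc) (e i.succ)) =
      ∑ b ∈ Finset.Ioi i.succ, F i.castSucc b := by
    rw [Finset.sum_mul]
    refine Finset.sum_congr rfl fun m hm => ?_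
    rw [capped_dperm H hY fix (hB _) (ne1 m hm).symm, Equiv.swap_apply_right,
      Equiv.swap_apply_of_ne_of_ne (ne0 m hm) (ne1 m hm)]
  have s4 : (∑ a ∈ Finset.Ioi i.succ, ∑ b ∈ Finset.Ioi a, F a b) *
      dperm θ (Equiv.swap (e i.castSucc) (e i.succ)) =
      ∑ a ∈ Finset.Ioi i.succ, ∑ b ∈ Finset.Ioi a, F a b := by
    simp only [Finset.sum_mul]
    refine Finset.sum_congr rfl fun a ha => Finset.sum_congr rfl fun b hb => ?_
    have hb' : b ∈ Finset.Ioi i.succ :=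
      Finset.mem_Ioi.2 ((Finset.mem_Ioi.1 ha).trans (Finset.mem_Ioi.1 hb))
    rw [capped_dperm H hY fix (hB _) (he.ne (Finset.mem_Ioi.1 hb).ne),
      Equiv.swap_apply_of_ne_of_ne (ne0 a ha) (ne1 a ha),
      Equiv.swap_apply_of_ne_of_ne (ne0 b hb') (ne1 b hb')]
  -- the action of the unit
  have u1 : ∀ m, E m * unitOp N θ = E m := fun m => moved_unit H _
  have u2 : ∀ a b, a < b → F a b * unitOp N θ = F a b := fun a b h =>
    capped_unit H (he.ne h.ne)
  have u3 : (∑ m ∈ Finset.Ioi i.succ, E m) * unitOp N θ = ∑ m ∈ Finset.Ioi i.succ, E m := by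
    rw [Finset.sum_mul]; exact Finset.sum_congr rfl fun m _ => u1 m
  have u4 : ∀ a, (∑ b ∈ Finset.Ioi a, F a b) * unitOp N θ = ∑ b ∈ Finset.Ioi a, F a b := by
    intro a
    rw [Finset.sum_mul]; exact Finset.sum_congr rfl fun b hb => u2 a b (Finset.mem_Ioi.1 hb)
  have u5 : (∑ a ∈ Finset.Ioi i.succ, ∑ b ∈ Finset.Ioi a, F a b) * unitOp N θ =
      ∑ a ∈ Finset.Ioi i.succ, ∑ b ∈ Finset.Ioi a, F a b := by
    rw [Finset.sum_mul]; exact Finset.sum_congr rfl fun a _ => u4 a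
  -- the action of the contraction
  have k1 : (∑ m ∈ Finset.Ioi i.succ, E m) *
      contrOp N θ hat chk (e i.castSucc) (e i.succ) = 0 := by
    rw [Finset.sum_mul]
    exact Finset.sum_eq_zero fun m hm =>
      moved_contr_zero H hY (hB _) (hB _) (hB _) hne (ne0 m hm) (ne1 m hm)
  have k2 : E i.succ * contrOp N θ hat chk (e i.castSucc) (e i.succ) = F i.castSucc i.succ := by
    rw [hF, contr_symm H]; rfl
  -- All j-1-i terms of the sum give the same operator, so the coefficient is their number.
  have k3 : (∑ b ∈ Finset.Ioi i.succ, F i.succ b) *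
      contrOp N θ hat chk (e i.castSucc) (e i.succ) =
      ((j : ℂ) - 1 - i.val) • F i.castSucc i.succ := by
    have : ∀ b ∈ Finset.Ioi i.succ, F i.succ b * contrOp N θ hat chk (e i.castSucc) (e i.succ) =
        F i.castSucc i.succ := by
      intro b hb
      have e1 : F i.succ b = F b i.succ := capped_symm H hY (hB _) (hB _) (ne1 b hb).symm
      rw [e1, contr_symm H]
      exact capped_contr_adjacent H hY (hB _) (hB _) (ne1 b hb) (ne0 b hb) hne.symm
    rw [Finset.sum_mul, Finset.sum_congr rfl this, Finset.sum_const, Fin.card_Ioi,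
      ← Nat.cast_smul_eq_nsmul ℂ]
    congr 1
    have := i.isLt
    rw [Fin.val_succ, Nat.cast_sub (by omega), Nat.cast_sub (by omega)]
    push_cast; ring
  have k4 : (∑ a ∈ Finset.Ioi i.succ, ∑ b ∈ Finset.Ioi a, F a b) *
      contrOp N θ hat chk (e i.castSucc) (e i.succ) = 0 := by
    simp only [Finset.sum_mul]
    refine Finset.sum_eq_zero fun a ha => Finset.sum_eq_zero fun b hb => ?_
    have hb' : b ∈ Finset.Ioi i.succ :=
      Finset.mem_Ioi.2 ((Finset.mem_Ioi.1 ha).trans (Finset.mem_Ioi.1 hb))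
    exact capped_contr_far H hY (hB _) (hB _) (hB _) (he.ne (Finset.mem_Ioi.1 hb).ne)
      (ne0 a ha) (ne0 b hb') (ne1 a ha) (ne1 b hb') hne
  rw [sum_Ioi_castSucc i E, sum_Ioi_castSucc i (F i.castSucc),
    sum_Ioi_castSucc i (fun a => ∑ b ∈ Finset.Ioi a, F a b)]
  simp only [mul_sub, mul_add, sub_mul, add_mul, smul_mul_assoc, mul_smul_comm, s1, s2, s3, s4,
    u1, u3, u4, u5, k1, k2, k3, k4, Fin.val_castSucc, Fin.val_succ]
  have d1 := hω i.val
  have d2 : ω + 2 * ((j : ℂ) - 1) ≠ 0 := by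
    have := i.isLt
    -- The existence of `i : Fin j` forces j ≥ 1, so j - 1 is a natural number.
    obtain ⟨j', rfl⟩ : ∃ j', j = j' + 1 := ⟨j - 1, by omega⟩
    simpa using hω j'
  have d3 : (i.val : ℂ) + 1 ≠ 0 := Nat.cast_add_one_ne_zero _
  have d4 : (i.val : ℂ) + 1 + 1 ≠ 0 := by
        exact_mod_cast Nat.succ_ne_zero (i.val + 1)
  push_cast
  generalize (i.val : ℂ) = r at *
  generalize (j : ℂ) = J at *
  match_scalars <;> field_simp <;> ring

/-- The invariant `partialValue` starts at Y when r is the last strand and ends at r = 0. The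
coefficient 2 becomes 1 on passing to ordered pairs. For j = 0 the denominator may vanish, but then
there are no pairs. -/
theorem IsStrandRep.map_Xi_succ (H : IsTriple θ hat chk ω) (hω : ∀ m : ℕ, ω + 2 * (m : ℂ) ≠ 0)
    {φ : BrauerAlgebra (j + 1) ω →ₙₐ[ℂ] TMat D N} {e : Fin (j + 1) → Fin N}
    (hφ : IsStrandRep θ hat chk φ e)
    (hY : RightTraceless θ hat chk (Set.range (e ∘ Fin.castSucc)) (φ (incl j ω (Xi ω j)))) :
    φ (Xi ω (j + 1)) =
      ∑ m, moved θ (φ (incl j ω (Xi ω j))) (e (Fin.last j)) (e m) -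
        (1 / (ω + 2 * ((j : ℂ) - 1))) • ∑ b, ∑ a ∈ Finset.univ.erase b,
          capped θ hat chk (φ (incl j ω (Xi ω j))) (e (Fin.last j)) (e a) (e b) := by
  have hB := range_insert_last e
  have key := reverse_prod_induction (fun i : Fin j => Rhat (j + 1) ω i (-((i.val : ℂ) + 1)))
    (fun r a => φ a = partialValue θ hat chk ω e (φ (incl j ω (Xi ω j))) r) (incl j ω (Xi ω j))
    ?_ ?_
  · rw [Xi, key, sum_sum_ne (fun a b => capped θ hat chk (φ (incl j ω (Xi ω j)))
      (e (Fin.last j)) (e a) (e b)) fun a b h => capped_symm H hY (hB a) (hB b) (hφ.inj.ne h)]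
    have z : ∀ f : Fin (j + 1) → TMat D N, ∑ m, f m = f 0 + ∑ m ∈ Finset.Ioi 0, f m := by
      intro f
      rw [← Finset.add_sum_erase _ _ (Finset.mem_univ (0 : Fin (j + 1)))]
      congr 2
      ext m; simp
    rw [z, z, partialValue]
    simp only [Fin.val_zero, Nat.cast_zero, zero_add, div_one, one_smul]
    module
  · have : Finset.Ioi (Fin.last j) = ∅ := by
      ext m; simp [Fin.le_last]
    simp only [partialValue, this, Finset.sum_empty, smul_zero, zero_add, sub_zero]
    exact (moved_self hY).symm
  · intro i b hb
    rw [map_mul, hb, hφ.map_Rhat H, partialValue_step H hω hφ.inj hY]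

/-- The rightmost factor suffices: (σ + 1 - (2/ω)κ)κ = κ + κ - 2κ = 0. -/
theorem IsStrandRep.map_Xi_succ_contr (H : IsTriple θ hat chk ω)
    (hω : ∀ m : ℕ, ω + 2 * (m : ℂ) ≠ 0)
    {φ : BrauerAlgebra (j + 1) ω →ₙₐ[ℂ] TMat D N} {e : Fin (j + 1) → Fin N}
    (hφ : IsStrandRep θ hat chk φ e) (i : Fin j) (hi : i.val = 0) :
    φ (Xi ω (j + 1)) * contrOp N θ hat chk (e i.castSucc) (e i.succ) = 0 := by
  have key := reverse_prod_induction (fun i : Fin j => Rhat (j + 1) ω i (-((i.val : ℂ) + 1)))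
    -- The invariant is vacuous until the last factor has been multiplied on.
    (fun r a => r.val = 0 → φ a * contrOp N θ hat chk (e i.castSucc) (e i.succ) = 0)
    (incl j ω (Xi ω j)) ?_ ?_
  · exact key rfl
  · intro h
    have := i.isLt
    simp at h; omega
  · intro i' b _ hi'
    obtain rfl : i = i' := Fin.ext (by rw [hi]; exact hi'.symm)
    have hne : e i.castSucc ≠ e i.succ := hφ.inj.ne i.castSucc_lt_succ.ne
    have h0 : ω ≠ 0 := by simpa using hω 0
    rw [map_mul, mul_assoc, hφ.map_Rhat H, sub_mul, add_mul, swap_contr H hne, smul_mul_assoc,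
      smul_mul_assoc, unit_mul_contr' H hne, contr_sq H hne, hi, Nat.cast_zero, smul_smul]
    have : 2 / (ω + 2 * 0) * ω = 2 := by rw [mul_zero, add_zero, div_mul_cancel₀ _ h0]
    rw [this]
    have : contrOp N θ hat chk (e i.castSucc) (e i.succ) + (1 / ((0 : ℂ) + 1)) •
      contrOp N θ hat chk (e i.castSucc) (e i.succ) -
      (2 : ℂ) • contrOp N θ hat chk (e i.castSucc) (e i.succ) = 0 := by
      match_scalars; norm_num
    rw [this, mul_zero]

theorem exists_perm_pair {B : Set (Fin N)} {a b c d : Fin N} (ha : a ∈ B) (hb : b ∈ B)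
    (hc : c ∈ B) (hd : d ∈ B) (h : a ≠ b) (h' : c ≠ d) :
    ∃ τ : Equiv.Perm (Fin N), (∀ x, x ∉ B → τ x = x) ∧ τ a = c ∧ τ b = d := by
  have hb' : Equiv.swap a c b ∈ B := perm_mem_of_fixed (swap_fixed ha hc) hb
  refine ⟨Equiv.swap (Equiv.swap a c b) d * Equiv.swap a c, fun x hx => ?_, ?_, ?_⟩
  · rw [Equiv.Perm.mul_apply, swap_fixed ha hc x hx, swap_fixed hb' hd x hx]
  · rw [Equiv.Perm.mul_apply, Equiv.swap_apply_left, Equiv.swap_apply_of_ne_of_ne _ h']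
    intro e
    exact h ((Equiv.swap a c).injective (by rw [Equiv.swap_apply_left]; exact e))
  · rw [Equiv.Perm.mul_apply, Equiv.swap_apply_left]

/-- The image of `Ξ_j` is symmetric and traceless on the right. -/
theorem IsStrandRep.rightTraceless (H : IsTriple θ hat chk ω)
    (hω : ∀ m : ℕ, ω + 2 * (m : ℂ) ≠ 0) : ∀ {j : ℕ}
    {φ : BrauerAlgebra j ω →ₙₐ[ℂ] TMat D N} {e : Fin j → Fin N}, IsStrandRep θ hat chk φ e →
    RightTraceless θ hat chk (Set.range e) (φ (Xi ω j))
  | 0, φ, e, hφ => by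
    refine ⟨fun τ hτ => ?_, ?_⟩
    · have : τ = 1 := Equiv.ext fun x => hτ x (by simp)
      rw [this, Xi, hφ.one, ← unitOp_eq_dperm, unitOp_sq H]
    · rintro _ ⟨i, -⟩; exact i.elim0
  | j + 1, φ, e, hφ => by
    have hY : RightTraceless θ hat chk (Set.range (e ∘ Fin.castSucc)) (φ (incl j ω (Xi ω j))) :=
      IsStrandRep.rightTraceless H hω hφ.comp_incl
    have hB := range_insert_last e
    have hperm : ∀ τ : Equiv.Perm (Fin N), (∀ x, x ∉ Set.range e → τ x = x) →
        φ (Xi ω (j + 1)) * dperm θ τ = φ (Xi ω (j + 1)) := by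
      intro τ hτ
      have hτ' : ∀ x, x ∉ insert (e (Fin.last j)) (Set.range (e ∘ Fin.castSucc)) → τ x = x := by
        rwa [insert_last_eq]
      have hm : ∀ m, ∃ m', e m' = τ (e m) := fun m => perm_mem_of_fixed hτ ⟨m, rfl⟩
      -- A permutation that fixes everything outside the range of e permutes the strand labels,
      -- which reindexes both sums in Ξ_{j+1}.
      choose ρ hρ using hm
      have ρinj : Function.Injective ρ := fun a b h =>
        hφ.inj (τ.injective (by rw [← hρ, ← hρ, h]))
      let ρ' : Equiv.Perm (Fin (j + 1)) := Equiv.ofBijective ρ (Finite.injective_iff_bijective.1 ρinj)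
      rw [hφ.map_Xi_succ H hω hY, sub_mul, smul_mul_assoc, Finset.sum_mul, Finset.sum_mul]
      congr 1
      · refine Fintype.sum_equiv ρ' _ _ fun m => ?_
        rw [moved_dperm H hY hτ' (hB m)]
        exact congrArg _ (hρ m).symm
      · congr 1
        refine Fintype.sum_equiv ρ' _ _ fun b => ?_
        rw [Finset.sum_mul]
        refine Finset.sum_equiv ρ' (fun a => by simp) fun a ha => ?_
        rw [capped_dperm H hY hτ' (hB a) (hφ.inj.ne (Finset.ne_of_mem_erase ha)), ← hρ, ← hρ]
        rfl
    refine ⟨hperm, ?_⟩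
    rintro _ ⟨a, rfl⟩ _ ⟨b, rfl⟩ hab
    have hj : 0 < j := by
      rcases Nat.eq_zero_or_pos j with rfl | h
      · exact absurd (congrArg e (Subsingleton.elim (α := Fin 1) a b)) hab
      · exact h
    let i : Fin j := ⟨0, hj⟩
    have hne : e i.castSucc ≠ e i.succ := hφ.inj.ne i.castSucc_lt_succ.ne
    -- Permutations act transitively on pairs of distinct factors, so the vanishing on the first
    -- pair carries over to every pair.
    obtain ⟨τ, h1, h2, h3⟩ := exists_perm_pair (B := Set.range e) ⟨i.castSucc, rfl⟩
      ⟨i.succ, rfl⟩ ⟨a, rfl⟩ ⟨b, rfl⟩ hne hab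
    rw [← h2, ← h3, ← hperm τ h1, mul_assoc, ← contr_mul_dperm H τ hne, ← mul_assoc,
      hφ.map_Xi_succ_contr H hω i rfl, zero_mul]

/-- The image of `Ξ_j` acts as `j!` on the operators that are symmetric and traceless on the
left. -/
theorem IsStrandRep.map_Xi_mul (H : IsTriple θ hat chk ω)
    (hω : ∀ m : ℕ, ω + 2 * (m : ℂ) ≠ 0) : ∀ {j : ℕ}
    {φ : BrauerAlgebra j ω →ₙₐ[ℂ] TMat D N} {e : Fin j → Fin N}, IsStrandRep θ hat chk φ e →
    ∀ {M : TMat D N}, unitOp N θ * M = M →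
    (∀ a b, a ≠ b → dperm θ (Equiv.swap (e a) (e b)) * M = M) →
    (∀ a b, a ≠ b → contrOp N θ hat chk (e a) (e b) * M = 0) →
    φ (Xi ω j) * M = (j.factorial : ℂ) • M
  | 0, φ, e, hφ, M, h1, _, _ => by
    rw [Xi, hφ.one, h1]; simp
  | j + 1, φ, e, hφ, M, h1, h2, h3 => by
    have ih : φ (incl j ω (Xi ω j)) * M = (j.factorial : ℂ) • M :=
      IsStrandRep.map_Xi_mul H hω hφ.comp_incl h1
        (fun a b h => h2 _ _ ((Fin.castSucc_injective j).ne h))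
        (fun a b h => h3 _ _ ((Fin.castSucc_injective j).ne h))
    have key := reverse_prod_induction (fun i : Fin j => Rhat (j + 1) ω i (-((i.val : ℂ) + 1)))
      -- The factors (i+2)/(i+1) telescope from i = j-1 down to i = r.
      (fun r a => φ a * M = (((j : ℂ) + 1) / ((r.val : ℂ) + 1) * (j.factorial : ℂ)) • M)
      (incl j ω (Xi ω j)) ?_ ?_
    · rw [Xi, key, Nat.factorial_succ]; push_cast; simp
    · have : (j : ℂ) + 1 ≠ 0 := Nat.cast_add_one_ne_zero j
      rw [ih, Fin.val_last, div_self this, one_mul]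
    · intro i b hb
      have hne := i.castSucc_lt_succ.ne
      have d3 : (i.val : ℂ) + 1 ≠ 0 := Nat.cast_add_one_ne_zero _
      have d4 : (i.val : ℂ) + 1 + 1 ≠ 0 := by
        exact_mod_cast Nat.succ_ne_zero (i.val + 1)
      have e1 : φ (Rhat (j + 1) ω i (-((i.val : ℂ) + 1))) * M =
          (((i.val : ℂ) + 2) / ((i.val : ℂ) + 1)) • M := by
        rw [hφ.map_Rhat H, sub_mul, add_mul, h2 _ _ hne, smul_mul_assoc, smul_mul_assoc, h1,
          h3 _ _ hne]
        match_scalars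
        field_simp; ring
      rw [map_mul, mul_assoc, e1, mul_smul_comm, hb, smul_smul]
      congr 1
      simp only [Fin.val_succ, Fin.val_castSucc]
      push_cast
      field_simp; ring

end Product

/-! ### Hermitian conjugation -/

section Adjoint
variable {p q j : ℕ}

/-- The hermitian conjugate of an operator for the metric of `ℝ^{p,q}`. -/
noncomputable def adj (M : TMat (p + q) j) : TMat (p + q) j := fun n r =>
  (∏ i, (eta p q (n i) : ℂ)) * (∏ i, (eta p q (r i) : ℂ)) * star (M r n)

theorem prod_eta_sq (n : Fin j → Fin (p + q)) :
    (∏ i, (eta p q (n i) : ℂ)) * (∏ i, (eta p q (n i) : ℂ)) = 1 := by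
  rw [← Finset.prod_mul_distrib]
  exact Finset.prod_eq_one fun i _ => eta_mul_self' p q (n i)

theorem star_prod_eta (n : Fin j → Fin (p + q)) :
    star (∏ i, (eta p q (n i) : ℂ)) = ∏ i, (eta p q (n i) : ℂ) := by
  rw [star_prod]
  exact Finset.prod_congr rfl fun i _ => Complex.conj_ofReal _

theorem adj_adj (M : TMat (p + q) j) : adj (adj M) = M := by
  ext n r
  simp only [adj, star_mul', star_prod_eta, star_star]
  linear_combination M n r * (∏ i, (eta p q (r i) : ℂ)) * (∏ i, (eta p q (r i) : ℂ)) *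
    prod_eta_sq n + M n r * prod_eta_sq r

theorem adj_mul (M N : TMat (p + q) j) : adj (M * N) = adj N * adj M := by
  ext n r
  simp only [adj, Matrix.mul_apply, star_sum, Finset.mul_sum, star_mul']
  refine Finset.sum_congr rfl fun m _ => ?_
  linear_combination -(∏ i, (eta p q (n i) : ℂ)) * (∏ i, (eta p q (r i) : ℂ)) *
    (star (M r m) * star (N m n)) * prod_eta_sq m

theorem adj_smul (c : ℂ) (M : TMat (p + q) j) : adj (c • M) = star c • adj M := by
  ext n r
  simp only [adj, Matrix.smul_apply, smul_eq_mul, star_mul']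
  ring

theorem adj_zero : adj (0 : TMat (p + q) j) = 0 := by
  ext n r; simp [adj]

theorem star_Theta (k : Fin (p + q) → ℝ) (n r : Fin (p + q)) :
    star (Theta p q k n r) = Theta p q k n r := Complex.conj_ofReal _

theorem Theta_swap (k : Fin (p + q) → ℝ) (n r : Fin (p + q)) :
    Theta p q k r n = (eta p q n : ℂ) * (eta p q r : ℂ) * Theta p q k n r := by
  linear_combination -(eta p q r : ℂ) * eta_Theta p q k n r -
    Theta p q k r n * eta_mul_self' p q r

/-- Conjugation inverts a permutation, and an exchange is its own inverse; Θ is self-adjoint for the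
metric by `Theta_swap`. -/
theorem adj_dperm_swap (k : Fin (p + q) → ℝ) (a b : Fin j) :
    adj (dperm (Theta p q k) (Equiv.swap a b)) = dperm (Theta p q k) (Equiv.swap a b) := by
  ext n r
  have e : (∏ i, (eta p q (n i) : ℂ)) = ∏ i, (eta p q (n (Equiv.swap a b i)) : ℂ) :=
    (Equiv.prod_comp (Equiv.swap a b) fun i => (eta p q (n i) : ℂ)).symm
  simp only [adj, dperm, kron, submatrix_apply, id, Function.comp, star_prod, star_Theta]
  rw [e, ← Finset.prod_mul_distrib, ← Finset.prod_mul_distrib,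
    ← Equiv.prod_comp (Equiv.swap a b) fun m => Theta p q k (n m) (r (Equiv.swap a b m))]
  refine Finset.prod_congr rfl fun m _ => ?_
  rw [Equiv.swap_apply_self]
  linear_combination -Theta_swap k (r m) (n (Equiv.swap a b m))

theorem adj_unitOp (k : Fin (p + q) → ℝ) :
    adj (unitOp j (Theta p q k)) = unitOp j (Theta p q k) := by
  ext n r
  simp only [adj, unitOp, star_prod, star_Theta]
  rw [← Finset.prod_mul_distrib, ← Finset.prod_mul_distrib]
  refine Finset.prod_congr rfl fun m _ => ?_
  linear_combination -Theta_swap k (r m) (n m)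

theorem star_ThetaUp (k : Fin (p + q) → ℝ) (n r : Fin (p + q)) :
    star (ThetaUp p q k n r) = (eta p q n : ℂ) * (eta p q r : ℂ) * ThetaLow p q k n r := by
  rw [ThetaUp, ThetaLow, star_mul', star_Theta, Theta_swap k n r,
    show star (eta p q r : ℂ) = (eta p q r : ℂ) from Complex.conj_ofReal _]
  linear_combination -(eta p q r : ℂ) * Theta p q k n r * (eta_mul_self' p q r +
    (eta p q r : ℂ) * (eta p q r : ℂ) * eta_mul_self' p q n)

theorem star_ThetaLow (k : Fin (p + q) → ℝ) (n r : Fin (p + q)) :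
    star (ThetaLow p q k n r) = (eta p q n : ℂ) * (eta p q r : ℂ) * ThetaUp p q k n r := by
  have h := congrArg star (star_ThetaUp k n r)
  rw [star_star, star_mul', star_mul', show star (eta p q r : ℂ) = (eta p q r : ℂ) from
    Complex.conj_ofReal _, show star (eta p q n : ℂ) = (eta p q n : ℂ) from
    Complex.conj_ofReal _] at h
  rw [h]
  linear_combination -star (ThetaLow p q k n r) * (eta_mul_self' p q n +
    (eta p q n : ℂ) * (eta p q n : ℂ) * eta_mul_self' p q r)

/-- Conjugation interchanges the upper form on the outputs with the lower form on the inputs, and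
these differ only by signs of the metric, each of which occurs squared. -/
theorem adj_contrOp (k : Fin (p + q) → ℝ) {a b : Fin j} (h : a ≠ b) :
    adj (contrOp j (Theta p q k) (ThetaLow p q k) (ThetaUp p q k) a b) =
      contrOp j (Theta p q k) (ThetaLow p q k) (ThetaUp p q k) a b := by
  ext n r
  have e : ∏ m ∈ Finset.univ \ {a, b}, Theta p q k (n m) (r m) =
      (∏ m ∈ Finset.univ \ {a, b}, (eta p q (n m) : ℂ)) *
      (∏ m ∈ Finset.univ \ {a, b}, (eta p q (r m) : ℂ)) *
      ∏ m ∈ Finset.univ \ {a, b}, Theta p q k (r m) (n m) := by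
    rw [← Finset.prod_mul_distrib, ← Finset.prod_mul_distrib]
    refine Finset.prod_congr rfl fun m _ => ?_
    rw [Theta_swap k (r m) (n m)]; ring
  simp only [adj, contrOp, star_mul', star_prod, star_Theta, star_ThetaUp, star_ThetaLow]
  rw [e, prod_split2 h (fun i => (eta p q (n i) : ℂ)), prod_split2 h (fun i => (eta p q (r i) : ℂ))]
  have e1 := eta_mul_self' p q (n a)
  have e2 := eta_mul_self' p q (n b)
  have e3 := eta_mul_self' p q (r a)
  have e4 := eta_mul_self' p q (r b)
  generalize (eta p q (n a) : ℂ) = A at *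
  generalize (eta p q (n b) : ℂ) = B at *
  generalize (eta p q (r a) : ℂ) = C at *
  generalize (eta p q (r b) : ℂ) = E at *
  have e5 : A * A * (B * B) * (C * C) * (E * E) = 1 := by rw [e1, e2, e3, e4]; ring
  linear_combination ThetaUp p q k (n a) (n b) * ThetaLow p q k (r a) (r b) *
    ((∏ m ∈ Finset.univ \ {a, b}, (eta p q (n m) : ℂ)) *
      (∏ m ∈ Finset.univ \ {a, b}, (eta p q (r m) : ℂ)) *
      ∏ m ∈ Finset.univ \ {a, b}, Theta p q k (r m) (n m)) * e5

end Adjoint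

/-! ### The operator `S_(k)(Ξ_j)` -/

section SXi
variable {p q : ℕ} {k : Fin (p + q) → ℝ}

/-- D ≥ 2 makes ω + 2m = D - 1 + 2m positive, so no denominator in R̂_i(-i) vanishes. -/
theorem omega_add_ne_zero (hD : 2 ≤ p + q) (m : ℕ) : omega p q + 2 * (m : ℂ) ≠ 0 := by
  obtain ⟨d, hd⟩ : ∃ d, p + q = d + 2 := ⟨p + q - 2, by omega⟩
  have : omega p q + 2 * (m : ℂ) = ((d + 1 + 2 * m : ℕ) : ℂ) := by
    rw [omega, hd]; push_cast; ring
  rw [this]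
  exact Nat.cast_ne_zero.2 (by omega)

theorem isStrandRep_S (hk : normSq p q k ≠ 0) (j : ℕ) :
    IsStrandRep (Theta p q k) (ThetaLow p q k) (ThetaUp p q k) (S p q hk j) id :=
  isStrandRep_rep _

theorem rightTraceless_S (hD : 2 ≤ p + q) (hk : normSq p q k ≠ 0) (j : ℕ) :
    RightTraceless (Theta p q k) (ThetaLow p q k) (ThetaUp p q k) Set.univ
      (S p q hk j (Xi (omega p q) j)) := by
  have h := (isStrandRep_S hk j).rightTraceless (isTriple_Theta p q hk) (omega_add_ne_zero hD)
  rwa [Set.range_id] at h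

/-- Conjugation turns the right symmetry and tracelessness of X into left ones for X†, so X X† = j!
X†. The left side is its own adjoint, which gives j! X† = j! X. -/
theorem adj_S (hD : 2 ≤ p + q) (hk : normSq p q k ≠ 0) (j : ℕ) :
    adj (S p q hk j (Xi (omega p q) j)) = S p q hk j (Xi (omega p q) j) := by
  have hR := rightTraceless_S hD hk j
  set X := S p q hk j (Xi (omega p q) j) with hX
  have h : X * adj X = (j.factorial : ℂ) • adj X := by
    refine (isStrandRep_S hk j).map_Xi_mul (isTriple_Theta p q hk) (omega_add_ne_zero hD) ?_ ?_ ?_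
    · rw [← adj_unitOp, ← adj_mul, hR.unit]
    · intro a b _
      rw [← adj_dperm_swap, ← adj_mul, hR.perm _ fun x hx => absurd (Set.mem_univ x) hx]
    · intro a b hab
      change contrOp j _ _ _ a b * _ = 0
      rw [← adj_contrOp k hab, ← adj_mul, hR.contr _ trivial _ trivial hab, adj_zero]
  have h2 := congrArg adj h
  rw [adj_mul, adj_adj, adj_smul, adj_adj, h, star_natCast] at h2
  exact smul_right_injective _ (Nat.cast_ne_zero.2 j.factorial_ne_zero) h2

/-- By hermiticity X is itself symmetric and traceless on the left, so Ξ_j acts on it as j!. -/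
theorem S_mul_self (hD : 2 ≤ p + q) (hk : normSq p q k ≠ 0) (j : ℕ) :
    S p q hk j (Xi (omega p q) j) * S p q hk j (Xi (omega p q) j) =
      (j.factorial : ℂ) • S p q hk j (Xi (omega p q) j) := by
  have hR := rightTraceless_S hD hk j
  have hA := adj_S hD hk j
  refine (isStrandRep_S hk j).map_Xi_mul (isTriple_Theta p q hk) (omega_add_ne_zero hD) ?_ ?_ ?_
  · rw [← adj_unitOp, ← hA, ← adj_mul, hR.unit]
  · intro a b _
    rw [← adj_dperm_swap, ← hA, ← adj_mul, hR.perm _ fun x hx => absurd (Set.mem_univ x) hx]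
  · intro a b hab
    change contrOp j _ _ _ a b * _ = 0
    rw [← adj_contrOp k hab, ← hA, ← adj_mul, hR.contr _ trivial _ trivial hab, adj_zero]

end SXi

/-! ### Consequences for the components -/

section Components
variable {D j : ℕ} {θ hat chk : Matrix (Fin D) (Fin D) ℂ} {ω : ℂ}

theorem apply_comp_perm {M : TMat D j} (h : M * unitOp j θ = M) {τ : Equiv.Perm (Fin j)}
    (hτ : M * dperm θ τ = M) (n r : Fin j → Fin D) : M n (r ∘ τ) = M n r := by
  have e := mul_kron_unit_submatrix (θ := θ) τ M
  have e2 : M * kron (fun _ => θ) = M := h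
  rw [e2] at e
  have e3 : M = M.submatrix id fun i => i ∘ τ := hτ.symm.trans e
  conv_rhs => rw [e3]
  rfl

/-- M factors through θ in every input, and θ annihilates v. -/
theorem sum_update_transverse {M : TMat D j} (h : M * unitOp j θ = M) {v : Fin D → ℂ}
    (hv : ∀ m, ∑ a, θ m a * v a = 0) (s : Fin j) (n r : Fin j → Fin D) :
    ∑ a, v a * M n (Function.update r s a) = 0 := by
  have e : ∀ a, v a * M n (Function.update r s a) =
      ∑ m, M n m * (∏ i ∈ Finset.univ.erase s, θ (m i) (r i)) * (θ (m s) a * v a) := by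
    intro a
    conv_lhs => rw [← h, Matrix.mul_apply, Finset.mul_sum]
    refine Finset.sum_congr rfl fun m _ => ?_
    rw [unitOp, ← Finset.mul_prod_erase _ _ (Finset.mem_univ s), Function.update_self]
    have : ∏ i ∈ Finset.univ.erase s, θ (m i) (Function.update r s a i) =
        ∏ i ∈ Finset.univ.erase s, θ (m i) (r i) :=
      Finset.prod_congr rfl fun i hi => by rw [Function.update_of_ne (Finset.ne_of_mem_erase hi)]
    rw [this]; ring
  rw [Finset.sum_congr rfl fun a _ => e a, Finset.sum_comm]
  refine Finset.sum_eq_zero fun m _ => ?_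
  rw [← Finset.mul_sum, hv, mul_zero]

/-- Since M absorbs θ, the metric trace of two inputs contracts M with `chk`. The vanishing of M κ
gives the same contraction multiplied by an entry of `hat`, so one nonzero entry suffices to cancel
it. -/
theorem sum_update_traceless {M : TMat D j} (h : M * unitOp j θ = M) {g : Fin D → ℂ}
    (hg : ∀ b c, ∑ a, g a * θ b a * θ c a = chk b c) {a₀ b₀ : Fin D} (hhat : hat a₀ b₀ ≠ 0)
    {s t : Fin j} (hst : s ≠ t) (hc : M * contrOp j θ hat chk s t = 0) (n r : Fin j → Fin D) :
    ∑ a, g a * M n (Function.update (Function.update r s a) t a) = 0 := by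
  have e : ∀ a, g a * M n (Function.update (Function.update r s a) t a) =
      ∑ m, M n m * (∏ i ∈ Finset.univ \ {s, t}, θ (m i) (r i)) * (g a * θ (m s) a * θ (m t) a) := by
    intro a
    conv_lhs => rw [← h, Matrix.mul_apply, Finset.mul_sum]
    refine Finset.sum_congr rfl fun m _ => ?_
    rw [unitOp, prod_split2 hst, Function.update_self, Function.update_of_ne hst,
      Function.update_self]
    have : ∏ i ∈ Finset.univ \ {s, t},
          θ (m i) (Function.update (Function.update r s a) t a i) =
        ∏ i ∈ Finset.univ \ {s, t}, θ (m i) (r i) :=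
      Finset.prod_congr rfl fun i hi => by
        simp only [Finset.mem_sdiff, Finset.mem_univ, true_and, Finset.mem_insert,
          Finset.mem_singleton, not_or] at hi
        rw [Function.update_of_ne hi.2, Function.update_of_ne hi.1]
    rw [this]; ring
  rw [Finset.sum_congr rfl fun a _ => e a, Finset.sum_comm]
  simp only [← Finset.mul_sum, hg]
  -- The inputs s and t are set to the indices of the nonzero entry; the remaining inputs are
  -- arbitrary.
  have e2 := congrFun (congrFun hc n) (Function.update (Function.update r s a₀) t b₀)
  rw [Matrix.mul_apply, Matrix.zero_apply] at e2
  refine mul_left_cancel₀ hhat ?_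
  rw [mul_zero, Finset.mul_sum, ← e2]
  refine Finset.sum_congr rfl fun m _ => ?_
  rw [contrOp, Function.update_self, Function.update_of_ne hst, Function.update_self]
  have : ∏ i ∈ Finset.univ \ {s, t},
        θ (m i) (Function.update (Function.update r s a₀) t b₀ i) =
      ∏ i ∈ Finset.univ \ {s, t}, θ (m i) (r i) :=
    Finset.prod_congr rfl fun i hi => by
      simp only [Finset.mem_sdiff, Finset.mem_univ, true_and, Finset.mem_insert,
        Finset.mem_singleton, not_or] at hi
      rw [Function.update_of_ne hi.2, Function.update_of_ne hi.1]
  rw [this]; ring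

/-- Otherwise θ = `chk * hat` would be zero, contradicting tr θ = ω ≠ 0. -/
theorem exists_hat_ne_zero (H : IsTriple θ hat chk ω) (hω : ω ≠ 0) : ∃ a b, hat a b ≠ 0 := by
  by_contra! hc
  have : hat = 0 := by ext a b; exact hc a b
  apply hω
  rw [← H.tr, ← H.chk_hat, this, mul_zero, trace_zero]

end Components

/-! ### Transversality and metric contraction of Θ -/

section ThetaComponents
variable {p q : ℕ} {k : Fin (p + q) → ℝ}

theorem sum_Theta_mul (hk : normSq p q k ≠ 0) (m : Fin (p + q)) :
    ∑ a, Theta p q k m a * (k a : ℂ) = 0 := by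
  simp only [Theta, ← Complex.ofReal_mul, ← Complex.ofReal_sum]
  have e : ∀ a, ((if m = a then (1 : ℝ) else 0) - (eta p q a * k a) * k m / normSq p q k) * k a =
      (if m = a then k m else 0) - k m / normSq p q k * (eta p q a * k a ^ 2) := by
    intro a
    by_cases h : m = a
    · subst h; simp; ring
    · simp [h]; ring
  rw [Finset.sum_congr rfl fun a _ => e a, Finset.sum_sub_distrib, ← Finset.mul_sum, ← normSq]
  simp [hk]

theorem sum_eta_Theta_Theta (hk : normSq p q k ≠ 0) (b c : Fin (p + q)) :
    ∑ a, (eta p q a : ℂ) * Theta p q k b a * Theta p q k c a = ThetaUp p q k b c := by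
  rw [ThetaUp, ← Theta_idem p q hk, Matrix.mul_apply, Finset.sum_mul, Theta_idem p q hk]
  refine Finset.sum_congr rfl fun a _ => ?_
  linear_combination -Theta p q k b a * (eta p q c : ℂ) * Theta_swap k c a -
    Theta p q k b a * (eta p q a : ℂ) * Theta p q k c a * eta_mul_self' p q c

end ThetaComponents

/-! ### Generating functions -/

section Act
variable {D j : ℕ} {R : Type*} [CommRing R] [Algebra ℂ R]

/-- The components of `M (v_1 ⊗ ⋯ ⊗ v_j)`, for vectors with components in an algebra. -/
noncomputable def act (M : TMat D j) (v : Fin j → Fin D → R) (n : Fin j → Fin D) : R :=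
  ∑ r : Fin j → Fin D, M n r • ∏ i, v i (r i)

theorem act_mul (M K : TMat D j) (v : Fin j → Fin D → R) (n : Fin j → Fin D) :
    act (M * K) v n = ∑ m, M n m • act K v m := by
  simp only [act, Matrix.mul_apply, Finset.sum_smul, Finset.smul_sum, smul_smul]
  exact Finset.sum_comm

theorem act_kron (B : Fin j → Matrix (Fin D) (Fin D) ℂ) (v : Fin j → Fin D → R)
    (n : Fin j → Fin D) : act (kron B) v n = ∏ i, ∑ r, B i (n i) r • v i r := by
  rw [Fintype.prod_sum]
  refine Finset.sum_congr rfl fun r _ => ?_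
  rw [Finset.prod_smul]; rfl

theorem act_sum {ι : Type*} (s : Finset ι) (M : ι → TMat D j) (v : Fin j → Fin D → R)
    (n : Fin j → Fin D) : act (∑ i ∈ s, M i) v n = ∑ i ∈ s, act (M i) v n := by
  simp only [act, Matrix.sum_apply, Finset.sum_smul]
  exact Finset.sum_comm

/-- Expanding a contraction into sums of one-site products separates the scalar that pairs the two
inputs from the projections at the other sites. -/
theorem act_contrOp (θ hat chk : Matrix (Fin D) (Fin D) ℂ) {r s : Fin j} (h : r ≠ s)
    (x : Fin D → R) (m : Fin j → Fin D) :
    act (contrOp j θ hat chk r s) (fun _ => x) m = chk (m r) (m s) •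
      ((∑ a, ∑ b, hat a b • (x a * x b)) *
        ∏ i ∈ Finset.univ \ {r, s}, ∑ c, θ (m i) c • x c) := by
  rw [contrOp_eq _ _ _ h]
  simp only [act_sum, act_kron]
  have split : ∀ f : Fin j → R, ∏ i, f i = f r * f s * ∏ i ∈ Finset.univ \ {r, s}, f i := by
    intro f
    rw [← Finset.prod_sdiff (Finset.subset_univ {r, s}), Finset.prod_pair h, mul_comm]
  simp only [split]
  have : ∀ a b, ∏ i ∈ Finset.univ \ {r, s}, ∑ c, site θ hat chk r s a b i (m i) c • x c =
      ∏ i ∈ Finset.univ \ {r, s}, ∑ c, θ (m i) c • x c := by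
    intro a b
    refine Finset.prod_congr rfl fun i hi => ?_
    simp at hi
    simp [site, hi]
  simp only [this, ← Finset.sum_mul, ← smul_mul_assoc]
  congr 1
  simp [site, h.symm, siteA, siteB, vecMulVec_apply, Pi.single_apply, Finset.smul_sum,
    Finset.mul_sum, ite_smul, smul_smul, mul_comm (chk _ _)]

end Act

/-! ### Adding a tensor factor -/

section Extend
variable {D j : ℕ}

/-- `M ⊗ θ`. -/
def extend (θ : Matrix (Fin D) (Fin D) ℂ) (M : TMat D j) : TMat D (j + 1) := fun n r =>
  M (n ∘ Fin.castSucc) (r ∘ Fin.castSucc) * θ (n (Fin.last j)) (r (Fin.last j))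

theorem sum_snoc {R : Type*} [AddCommMonoid R] (g : (Fin (j + 1) → Fin D) → R) :
    ∑ f, g f = ∑ f : Fin j → Fin D, ∑ c : Fin D,
      g (Fin.snoc (α := fun _ : Fin (j + 1) => Fin D) f c) := by
  rw [← Equiv.sum_comp (Fin.snocEquiv fun _ => Fin D) g, Fintype.sum_prod_type, Finset.sum_comm]
  rfl

theorem snoc_comp (f : Fin j → Fin D) (c : Fin D) :
    (Fin.snoc (α := fun _ : Fin (j + 1) => Fin D) f c) ∘ Fin.castSucc = f := by
  ext i; simp

theorem sum_snoc_extend {R : Type*} [AddCommMonoid R] [Module ℂ R]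
    (θ : Matrix (Fin D) (Fin D) ℂ) (M : TMat D j) (n : Fin (j + 1) → Fin D)
    (g : (Fin (j + 1) → Fin D) → R) :
    ∑ m, extend θ M n m • g m = ∑ m : Fin j → Fin D, M (n ∘ Fin.castSucc) m •
      ∑ c : Fin D, θ (n (Fin.last j)) c • g (Fin.snoc (α := fun _ : Fin (j + 1) => Fin D) m c) := by
  rw [sum_snoc]
  simp only [extend, snoc_comp, Fin.snoc_last, Finset.smul_sum, smul_smul]

theorem extend_mul {θ : Matrix (Fin D) (Fin D) ℂ} (h : θ * θ = θ) (M K : TMat D j) :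
    extend θ (M * K) = extend θ M * extend θ K := by
  ext n r
  rw [Matrix.mul_apply]
  simp only [← smul_eq_mul (a := extend θ M n _)]
  rw [sum_snoc_extend]
  simp only [extend, snoc_comp, Fin.snoc_last]
  conv_lhs => rw [← h]
  simp only [Matrix.mul_apply, Finset.sum_mul, Finset.mul_sum, smul_eq_mul]
  rw [Finset.sum_comm]
  exact Finset.sum_congr rfl fun m _ => Finset.sum_congr rfl fun c _ => by ring

theorem extend_unitOp (θ : Matrix (Fin D) (Fin D) ℂ) :
    extend θ (unitOp j θ) = unitOp (j + 1) θ := by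
  ext n r
  simp only [extend, unitOp, Fin.prod_univ_castSucc]; rfl

theorem swap_castSucc (a b i : Fin j) : Equiv.swap a.castSucc b.castSucc i.castSucc =
    (Equiv.swap a b i).castSucc :=
  (Fin.castSucc_injective j).swap_apply a b i

theorem extend_permOp (θ : Matrix (Fin D) (Fin D) ℂ) (a b : Fin j) :
    extend θ (permOp j θ a b) = permOp (j + 1) θ a.castSucc b.castSucc := by
  ext n r
  simp only [extend, permOp, Fin.prod_univ_castSucc, swap_castSucc]
  rw [Equiv.swap_apply_of_ne_of_ne (Fin.castSucc_lt_last a).ne' (Fin.castSucc_lt_last b).ne']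
  rfl

theorem prod_sdiff_castSucc {R : Type*} [CommMonoid R] (a b : Fin j) (f : Fin (j + 1) → R) :
    ∏ m ∈ Finset.univ \ {a.castSucc, b.castSucc}, f m =
      (∏ m ∈ Finset.univ \ {a, b}, f m.castSucc) * f (Fin.last j) := by
  have : Finset.univ \ {a.castSucc, b.castSucc} =
      insert (Fin.last j) ((Finset.univ \ {a, b}).map Fin.castSuccEmb) := by
    ext m
    induction m using Fin.lastCases with
    | last => simp [(Fin.castSucc_lt_last a).ne', (Fin.castSucc_lt_last b).ne']
    | cast i => simp [(Fin.castSucc_lt_last i).ne]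
  rw [this, Finset.prod_insert (by simp), Finset.prod_map, mul_comm]
  rfl

theorem prod_sdiff_last {R : Type*} [CommMonoid R] (a : Fin j) (f : Fin (j + 1) → R) :
    ∏ m ∈ Finset.univ \ {a.castSucc, Fin.last j}, f m =
      ∏ m ∈ Finset.univ.erase a, f m.castSucc := by
  have : Finset.univ \ {a.castSucc, Fin.last j} =
      (Finset.univ.erase a).map Fin.castSuccEmb := by
    ext m
    induction m using Fin.lastCases with
    | last => simp
    | cast i => simp [(Fin.castSucc_lt_last i).ne]
  rw [this, Finset.prod_map]
  rfl

theorem extend_contrOp (θ hat chk : Matrix (Fin D) (Fin D) ℂ) (a b : Fin j) :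
    extend θ (contrOp j θ hat chk a b) =
      contrOp (j + 1) θ hat chk a.castSucc b.castSucc := by
  ext n r
  simp only [extend, contrOp, prod_sdiff_castSucc, mul_assoc]
  rfl

theorem extend_add (θ : Matrix (Fin D) (Fin D) ℂ) (M K : TMat D j) :
    extend θ (M + K) = extend θ M + extend θ K := by
  ext n r; simp [extend, add_mul]

theorem extend_smul (θ : Matrix (Fin D) (Fin D) ℂ) (c : ℂ) (M : TMat D j) :
    extend θ (c • M) = c • extend θ M := by
  ext n r; simp [extend, mul_assoc]

/-- Enough to check on generators, because `extend` is multiplicative when θ is idempotent. Scalars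
need care: the unit goes to the tensor power of θ, not to the identity matrix. -/
theorem rep_incl {θ hat chk : Matrix (Fin D) (Fin D) ℂ} {ω : ℂ} (H : IsTriple θ hat chk ω)
    (a : BrauerAlgebra j ω) : rep (j + 1) H (incl j ω a) = extend θ (rep j H a) := by
  obtain ⟨x, rfl⟩ := RingQuot.mkAlgHom_surjective ℂ (BrauerRel j ω) a
  induction x using FreeAlgebra.induction with
  | grade0 c =>
    rw [AlgHom.commutes, AlgHom.commutes, Algebra.algebraMap_eq_smul_one,
      Algebra.algebraMap_eq_smul_one, map_smul, map_smul, rep_one, rep_one, extend_smul,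
      extend_unitOp]
  | grade1 g =>
    cases g with
    | sigma r =>
      change rep (j + 1) H (incl j ω (sigma j ω r)) = extend θ (rep j H (sigma j ω r))
      rw [incl_sigma, rep_sigma, rep_sigma, extend_permOp]
      rfl
    | kappa r =>
      change rep (j + 1) H (incl j ω (kappa j ω r)) = extend θ (rep j H (kappa j ω r))
      rw [incl_kappa, rep_kappa, rep_kappa, extend_contrOp]
      rfl
  | mul x y hx hy => simp only [map_mul, hx, hy, extend_mul H.idem]
  | add x y hx hy => simp only [map_add, hx, hy, extend_add]

end Extend

/-! ### The differential operators -/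

section Differential
variable {p q j : ℕ}

theorem prod_update_erase {R : Type*} [CommRing R] {D : ℕ} (v : Fin j → Fin D → R) (s : Fin j)
    (w : Fin D → R) (r : Fin j → Fin D) :
    ∏ i, Function.update v s w i (r i) = w (r s) * ∏ i ∈ Finset.univ.erase s, v i (r i) := by
  rw [← Finset.mul_prod_erase _ _ (Finset.mem_univ s), Function.update_self]
  exact congrArg _ (Finset.prod_congr rfl fun i hi => by
    rw [Function.update_of_ne (Finset.ne_of_mem_erase hi)])

theorem derivation_prod {R : Type*} [CommRing R] [Algebra ℂ R] (d : Derivation ℂ R R)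
    {ι : Type*} [DecidableEq ι] (s : Finset ι) (f : ι → R) :
    d (∏ i ∈ s, f i) = ∑ i ∈ s, d (f i) * ∏ l ∈ s.erase i, f l := by
  induction s using Finset.induction_on with
  | empty => simp
  | insert a s ha ih =>
    rw [Finset.prod_insert ha, Derivation.leibniz, ih, Finset.sum_insert ha,
      Finset.erase_insert ha, smul_eq_mul, smul_eq_mul, Finset.mul_sum, add_comm, mul_comm (d _)]
    rw [mul_comm]
    refine congrArg₂ _ rfl (Finset.sum_congr rfl fun i hi => ?_)
    rw [Finset.erase_insert_of_ne (by rintro rfl; exact ha hi), Finset.prod_insert (by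
      simp [ha])]
    ring

/-- Leibniz formula for an iterated derivation; since d² z = 0, only the terms with at most one d on
z survive. -/
theorem derivation_iterate_mul {R : Type*} [CommRing R] [Algebra ℂ R] (d : Derivation ℂ R R)
    {z y : R} (hz : d z = y) (hy : d y = 0) (w : R) (m : ℕ) :
    ((d : R →ₗ[ℂ] R) ^ (m + 1)) (z * w) =
      z * ((d : R →ₗ[ℂ] R) ^ (m + 1)) w + ((m : ℂ) + 1) • (y * ((d : R →ₗ[ℂ] R) ^ m) w) := by
  induction m with
  | zero =>
    simp [hz, mul_comm]
  | succ m ih =>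
    have e : ∀ (n : ℕ) (v : R), ((d : R →ₗ[ℂ] R) ^ (n + 1)) v = d (((d : R →ₗ[ℂ] R) ^ n) v) :=
      fun n v => by rw [pow_succ', Module.End.mul_apply, Derivation.coeFn_coe]
    rw [e, ih, map_add, Derivation.map_smul, Derivation.leibniz, Derivation.leibniz, hz, hy, ← e, ← e]
    simp only [smul_eq_mul, mul_zero, add_zero]
    push_cast
    rw [mul_comm _ y]
    module

/-- Each factor can be hit at most once, so m applications hit every factor exactly once, in m!
orders. The vanishing of one further application is proved along with it because the inductive step
needs it. -/
theorem derivation_iterate_prod {R : Type*} [CommRing R] [Algebra ℂ R] (d : Derivation ℂ R R) :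
    ∀ {m : ℕ} (z y : Fin m → R), (∀ i, d (z i) = y i) → (∀ i, d (y i) = 0) →
    ((d : R →ₗ[ℂ] R) ^ m) (∏ i, z i) = (m.factorial : ℂ) • ∏ i, y i ∧
      ((d : R →ₗ[ℂ] R) ^ (m + 1)) (∏ i, z i) = 0
  | 0, z, y, _, _ => by simp
  | m + 1, z, y, hz, hy => by
    obtain ⟨h1, h2⟩ := derivation_iterate_prod d (fun i => z i.succ) (fun i => y i.succ)
      (fun i => hz _) (fun i => hy _)
    rw [Fin.prod_univ_succ, Fin.prod_univ_succ]
    constructor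
    · rw [derivation_iterate_mul d (hz 0) (hy 0), h2, h1, Nat.factorial_succ, mul_zero, zero_add,
        mul_smul_comm, smul_smul]
      push_cast; rfl
    · rw [derivation_iterate_mul d (hz 0) (hy 0), pow_succ', Module.End.mul_apply, h2]
      simp

theorem derivation_iterate_const_mul {R : Type*} [CommRing R] [Algebra ℂ R]
    (d : Derivation ℂ R R) {c : R} (hc : d c = 0) (w : R) (m : ℕ) :
    ((d : R →ₗ[ℂ] R) ^ m) (c * w) = c * ((d : R →ₗ[ℂ] R) ^ m) w := by
  induction m with
  | zero => rfl
  | succ m ih =>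
    rw [pow_succ', Module.End.mul_apply, ih, Module.End.mul_apply, Derivation.coeFn_coe,
      Derivation.leibniz, hc]
    simp

/-- The derivation that replaces the components of the vector `b` by `w`. -/
noncomputable def replaceD {D : ℕ} (b : Letter) (w : Fin D → Poly D) :
    Derivation ℂ (Poly D) (Poly D) :=
  ∑ n, w n • MvPolynomial.pderiv (b, n)

theorem replaceD_apply {D : ℕ} (b : Letter) (w : Fin D → Poly D) (f : Poly D) :
    replaceD b w f = ∑ n, w n * MvPolynomial.pderiv (b, n) f := by
  have h := congrFun (map_sum (Derivation.coeFnAddMonoidHom (R := ℂ) (A := Poly D) (M := Poly D))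
    (fun n => w n • MvPolynomial.pderiv (b, n)) Finset.univ) f
  rw [Finset.sum_apply] at h
  exact h

theorem replaceD_vec_self {D : ℕ} (b : Letter) (w : Fin D → Poly D) (r : Fin D) :
    replaceD b w (vec b r) = w r := by
  classical
  rw [replaceD_apply, Finset.sum_eq_single r]
  · simp [vec]
  · intro n _ hn
    rw [vec, MvPolynomial.pderiv_X_of_ne (by simpa using Ne.symm hn), mul_zero]
  · simp

theorem replaceD_vec_ne {D : ℕ} {a b : Letter} (h : a ≠ b) (w : Fin D → Poly D) (r : Fin D) :
    replaceD b w (vec a r) = 0 := by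
  rw [replaceD_apply]
  refine Finset.sum_eq_zero fun n _ => ?_
  rw [vec, MvPolynomial.pderiv_X_of_ne (by simp [h]), mul_zero]

theorem dirD_eq {D : ℕ} (a b : Letter) :
    (dirD a b : Module.End ℂ (Poly D)) =
      ((replaceD b (vec a) : Derivation ℂ (Poly D) (Poly D)) : Poly D →ₗ[ℂ] Poly D) := by
  refine LinearMap.ext fun f => ?_
  rw [Derivation.coeFn_coe, replaceD_apply, dirD, LinearMap.sum_apply]
  rfl

/-- The components of the projection of a vector. -/
noncomputable def projVec (p q : ℕ) (k : Fin (p + q) → ℝ) (a : Letter) (n : Fin (p + q)) :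
    Poly (p + q) :=
  ∑ r, Theta p q k n r • vec a r

theorem formD_eq (k : Fin (p + q) → ℝ) (a b : Letter) :
    formD p q k a b = (replaceD b (projVec p q k a) : Poly (p + q) →ₗ[ℂ] Poly (p + q)) := by
  refine LinearMap.ext fun f => ?_
  rw [Derivation.coeFn_coe, replaceD_apply, formD, LinearMap.sum_apply]
  simp only [projVec, Finset.sum_mul, LinearMap.sum_apply]
  rw [Finset.sum_comm]
  refine Finset.sum_congr rfl fun n _ => Finset.sum_congr rfl fun r _ => ?_
  rw [smul_mul_assoc]; rfl

end Differential

/-! ### Generating functions of the terms of Ξ_{j+1} -/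

section GenFun
variable {p q j : ℕ} {k : Fin (p + q) → ℝ}

/-- The product of the lowered components of `b`. -/
noncomputable def lowProd (p q : ℕ) {j : ℕ} (b : Letter) (n : Fin j → Fin (p + q)) :
    Poly (p + q) :=
  ∏ i, (eta p q (n i) : ℂ) • vec b (n i)

theorem genFun_eq_act (M : TMat (p + q) j) (a b : Letter) :
    genFun p q M a b = ∑ n, lowProd p q b n * act M (fun _ => vec a) n := by
  simp only [genFun, act, lowProd, Finset.mul_sum, mul_smul_comm]

theorem genFun_smul (c : ℂ) (M : TMat (p + q) j) (a b : Letter) :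
    genFun p q (c • M) a b = c • genFun p q M a b := by
  simp only [genFun, Matrix.smul_apply, smul_assoc, Finset.smul_sum]

theorem genFun_sub (M K : TMat (p + q) j) (a b : Letter) :
    genFun p q (M - K) a b = genFun p q M a b - genFun p q K a b := by
  simp only [genFun, Matrix.sub_apply, sub_smul, Finset.sum_sub_distrib]

theorem genFun_sum {ι : Type*} (s : Finset ι) (M : ι → TMat (p + q) j) (a b : Letter) :
    genFun p q (∑ i ∈ s, M i) a b = ∑ i ∈ s, genFun p q (M i) a b := by
  simp only [genFun_eq_act, act_sum, Finset.mul_sum]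
  exact Finset.sum_comm

/-- All inputs are filled with the same vector, so permuting them changes nothing. -/
theorem genFun_mul_dperm {θ : Matrix (Fin (p + q)) (Fin (p + q)) ℂ} {M : TMat (p + q) j}
    (h : M * unitOp j θ = M) (τ : Equiv.Perm (Fin j)) (a b : Letter) :
    genFun p q (M * dperm θ τ) a b = genFun p q M a b := by
  have e := mul_kron_unit_submatrix (θ := θ) τ M
  have e2 : M * kron (fun _ => θ) = M := h
  rw [e2] at e
  rw [dperm, e]
  unfold genFun
  refine Finset.sum_congr rfl fun n _ => ?_
  refine Fintype.sum_equiv (Equiv.arrowCongr τ.symm (Equiv.refl _)) _ _ fun r => ?_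
  have : (Equiv.arrowCongr τ.symm (Equiv.refl (Fin (p + q)))) r = r ∘ τ := by
    ext m; simp [Equiv.arrowCongr]
  rw [this, ← Equiv.prod_comp τ fun i => vec a (r i)]
  rfl

theorem lowProd_snoc (b : Letter) (n : Fin j → Fin (p + q)) (c : Fin (p + q)) :
    lowProd p q b (Fin.snoc (α := fun _ : Fin (j + 1) => Fin (p + q)) n c) =
      lowProd p q b n * ((eta p q c : ℂ) • vec b c) := by
  simp only [lowProd, Fin.prod_univ_castSucc, Fin.snoc_castSucc, Fin.snoc_last]

theorem form_eq (a b : Letter) : form p q k a b =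
    ∑ c, ((eta p q c : ℂ) • vec b c) * projVec p q k a c := by
  simp only [form, projVec, Finset.mul_sum]
  rw [Finset.sum_comm]
  refine Finset.sum_congr rfl fun c _ => Finset.sum_congr rfl fun r _ => ?_
  rw [smul_mul_smul_comm, smul_smul, mul_comm (vec a r)]

theorem form_eq_low (a : Letter) : form p q k a a =
    ∑ c, ∑ d, ThetaLow p q k c d • (vec a c * vec a d) := by
  refine Finset.sum_congr rfl fun c _ => Finset.sum_congr rfl fun d _ => ?_
  rw [smul_smul, ThetaLow, mul_comm]

theorem genFun_extend (M : TMat (p + q) j) (a b : Letter) :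
    genFun p q (extend (Theta p q k) M) a b = form p q k a b * genFun p q M a b := by
  have e : ∀ n : Fin (j + 1) → Fin (p + q), act (extend (Theta p q k) M) (fun _ => vec a) n =
      act M (fun _ => vec a) (n ∘ Fin.castSucc) * projVec p q k a (n (Fin.last j)) := by
    intro n
    rw [act, sum_snoc_extend, act, Finset.sum_mul]
    refine Finset.sum_congr rfl fun m _ => ?_
    simp only [Fin.prod_univ_castSucc, Fin.snoc_castSucc, Fin.snoc_last, projVec, smul_mul_assoc,
      Finset.mul_sum, mul_smul_comm, Finset.smul_sum]
    exact Finset.sum_congr rfl fun c _ => smul_comm _ _ _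
  rw [genFun_eq_act, sum_snoc, form_eq, genFun_eq_act, Finset.mul_sum]
  refine Finset.sum_congr rfl fun n _ => ?_
  rw [Finset.sum_mul]
  refine Finset.sum_congr rfl fun c _ => ?_
  rw [e, lowProd_snoc, snoc_comp, Fin.snoc_last]
  ring

/-- Since M absorbs Θ in each input, every argument may be replaced by its projection. -/
theorem act_update_proj {M : TMat (p + q) j} (h : M * unitOp j (Theta p q k) = M)
    (a b : Letter) (s : Fin j) (n : Fin j → Fin (p + q)) :
    act M (Function.update (fun _ => vec a) s (vec b)) n =
      ∑ m, M n m • (projVec p q k b (m s) *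
        ∏ i ∈ Finset.univ.erase s, projVec p q k a (m i)) := by
  conv_lhs => rw [← h, act_mul]
  refine Finset.sum_congr rfl fun m _ => congrArg _ ?_
  have : unitOp j (Theta p q k) = kron fun _ => Theta p q k := rfl
  rw [this, act_kron, ← Finset.mul_prod_erase _ _ (Finset.mem_univ s)]
  simp only [Function.update_self]
  refine congrArg _ (Finset.prod_congr rfl fun i hi => ?_)
  rw [Function.update_of_ne (Finset.ne_of_mem_erase hi)]; rfl

/-- This is the path of the vector b through a contraction: it enters at the output of the spectator
and reaches an input of the operator projected by Θ. -/
theorem sum_low_ThetaUp (hk : normSq p q k ≠ 0) (b : Letter) (m : Fin (p + q)) :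
    ∑ d, ∑ c, Theta p q k d c • (ThetaUp p q k m c • ((eta p q d : ℂ) • (vec b d : Poly (p + q)))) =
      projVec p q k b m := by
  rw [projVec]
  refine Finset.sum_congr rfl fun d _ => ?_
  have e := congrFun (congrFun (chk_th (isTriple_Theta p q hk)) m) d
  simp only [Matrix.mul_apply, transpose_apply] at e
  simp only [smul_smul, ← Finset.sum_smul]
  congr 1
  have : ∀ c, Theta p q k d c * (ThetaUp p q k m c * (eta p q d : ℂ)) =
      ThetaUp p q k m c * Theta p q k d c * (eta p q d : ℂ) := fun c => by ring
  rw [Finset.sum_congr rfl fun c _ => this c, ← Finset.sum_mul, e, ThetaUp, mul_assoc,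
    eta_mul_self', mul_one]

/-- The contraction pairs two inputs into Θ^(a)_(a) and links the output of the spectator to the
input s, where b therefore takes the place of a. -/
theorem genFun_extend_contr (hk : normSq p q k ≠ 0) {M : TMat (p + q) j}
    (h : M * unitOp j (Theta p q k) = M) (a b : Letter) (s : Fin j) :
    genFun p q (extend (Theta p q k) M * contrOp (j + 1) (Theta p q k) (ThetaLow p q k)
        (ThetaUp p q k) s.castSucc (Fin.last j)) a b =
      form p q k a a *
        ∑ n, lowProd p q b n * act M (Function.update (fun _ => vec a) s (vec b)) n := by
  have e : ∀ (n : Fin j → Fin (p + q)) (d : Fin (p + q)),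
      act (extend (Theta p q k) M * contrOp (j + 1) (Theta p q k) (ThetaLow p q k)
        (ThetaUp p q k) s.castSucc (Fin.last j)) (fun _ => vec a)
        (Fin.snoc (α := fun _ : Fin (j + 1) => Fin (p + q)) n d) =
      ∑ m, M n m • ((∑ c, (Theta p q k d c * ThetaUp p q k (m s) c) •
        (form p q k a a * ∏ i ∈ Finset.univ.erase s, projVec p q k a (m i)))) := by
    intro n d
    rw [act_mul, sum_snoc_extend]
    simp only [act_contrOp _ _ _ (Fin.castSucc_lt_last s).ne, prod_sdiff_last, Fin.snoc_castSucc,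
      Fin.snoc_last, snoc_comp, ← form_eq_low, smul_smul]
    rfl
  rw [genFun_eq_act, sum_snoc, Finset.mul_sum]
  refine Finset.sum_congr rfl fun n _ => ?_
  simp only [e, act_update_proj h, lowProd_snoc]
  simp only [← sum_low_ThetaUp hk, Finset.mul_sum, Finset.sum_mul, Finset.smul_sum]
  rw [Finset.sum_comm]
  refine Finset.sum_congr rfl fun m _ => Finset.sum_congr rfl fun d _ =>
    Finset.sum_congr rfl fun c _ => ?_
  simp only [smul_mul_assoc, mul_smul_comm, smul_smul]
  refine congrArg₂ _ (by ring) (by ring)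

theorem replaceD_lowProd {a b : Letter} (h : b ≠ a) (w : Fin (p + q) → Poly (p + q))
    (n : Fin j → Fin (p + q)) : replaceD a w (lowProd p q b n) = 0 := by
  rw [lowProd, derivation_prod]
  refine Finset.sum_eq_zero fun i _ => ?_
  rw [Derivation.map_smul, replaceD_vec_ne h, smul_zero, zero_mul]

/-- Product rule: the derivative replaces a by b in one input at a time, which matches the terms of
`genFun_extend_contr`. -/
theorem dirD_genFun {a b : Letter} (h : b ≠ a) (M : TMat (p + q) j) :
    dirD b a (genFun p q M a b) =
      ∑ s, ∑ n, lowProd p q b n * act M (Function.update (fun _ => vec a) s (vec b)) n := by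
  rw [dirD_eq, Derivation.coeFn_coe, genFun_eq_act, map_sum, Finset.sum_comm]
  refine Finset.sum_congr rfl fun n _ => ?_
  rw [Derivation.leibniz, replaceD_lowProd h, smul_zero, add_zero, smul_eq_mul, ← Finset.mul_sum]
  congr 1
  simp only [act]
  rw [map_sum, Finset.sum_comm]
  refine Finset.sum_congr rfl fun r _ => ?_
  rw [Derivation.map_smul, derivation_prod, Finset.smul_sum]
  refine Finset.sum_congr rfl fun s _ => congrArg _ ?_
  rw [prod_update_erase, replaceD_vec_self]

/-- The derivation replaces z by the projection of x and vanishes on the result, so j applications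
replace all j arguments, in j! orders; M absorbs the projections. -/
theorem formD_pow_genFun {M : TMat (p + q) j} (h : M * unitOp j (Theta p q k) = M) :
    (formD p q k .x .z ^ j) (genFun p q M .z .u) =
      (j.factorial : ℂ) • genFun p q M .x .u := by
  have e : ∀ n, act M (fun _ => (vec .x : Fin (p + q) → Poly (p + q))) n =
      ∑ m, M n m • ∏ i, projVec p q k .x (m i) := by
    intro n
    conv_lhs => rw [← h, act_mul]
    refine Finset.sum_congr rfl fun m _ => congrArg _ ?_
    have : unitOp j (Theta p q k) = kron fun _ => Theta p q k := rfl
    rw [this, act_kron]; rfl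
  rw [formD_eq, genFun_eq_act, genFun_eq_act, map_sum, Finset.smul_sum]
  refine Finset.sum_congr rfl fun n _ => ?_
  rw [derivation_iterate_const_mul _ (replaceD_lowProd (by simp) _ n), e, act, map_sum,
    ← mul_smul_comm, Finset.smul_sum]
  refine congrArg _ (Finset.sum_congr rfl fun m _ => ?_)
  rw [map_smul, (derivation_iterate_prod (replaceD .z (projVec p q k .x))
    (fun i => vec .z (m i)) (fun i => projVec p q k .x (m i)) (fun i => replaceD_vec_self _ _ _)
    fun i => ?_).1, smul_comm]
  rw [projVec, map_sum]
  exact Finset.sum_eq_zero fun r _ => by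
    rw [Derivation.map_smul, replaceD_vec_ne (by simp), smul_zero]

/-- Each of the j+1 terms E_m contributes Θ^(x)_(u) Ξ, and for each of the j+1 values of b the sum
over a of F_ab contributes Θ^(x)_(x) (u·∂_x) Ξ. -/
theorem genFun_S_succ (hD : 2 ≤ p + q) (hk : normSq p q k ≠ 0) (j : ℕ) :
    genFun p q (S p q hk (j + 1) (Xi (omega p q) (j + 1))) .x .u =
      ((j : ℂ) + 1) • (form p q k .x .u * genFun p q (S p q hk j (Xi (omega p q) j)) .x .u -
        (1 / (omega p q + 2 * ((j : ℂ) - 1))) • (form p q k .x .x *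
          dirD .u .x (genFun p q (S p q hk j (Xi (omega p q) j)) .x .u))) := by
  have H := isTriple_Theta p q hk
  have hω := omega_add_ne_zero hD
  have hM := (rightTraceless_S hD hk j).unit
  have hφ := isStrandRep_S hk (j + 1)
  have hY := hφ.comp_incl.rightTraceless H hω
  have hX : S p q hk (j + 1) (incl j _ (Xi (omega p q) j)) =
      extend (Theta p q k) (S p q hk j (Xi (omega p q) j)) := rep_incl H _
  change RightTraceless _ _ _ _ (S p q hk (j + 1) (incl j _ (Xi (omega p q) j))) at hY
  have hf := hφ.map_Xi_succ H hω hY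
  have hB : ∀ m, m ∈ insert (Fin.last j) (Set.range (id ∘ Fin.castSucc)) :=
    range_insert_last (id : Fin (j + 1) → Fin (j + 1))
  rw [hX] at hf hY
  set M := S p q hk j (Xi (omega p q) j) with hMdef
  have c1 : ∀ b : Fin (j + 1), ∑ a ∈ Finset.univ.erase b,
      genFun p q (capped (Theta p q k) (ThetaLow p q k) (ThetaUp p q k)
        (extend (Theta p q k) M) (Fin.last j) a b) .x .u =
      form p q k .x .x * dirD .u .x (genFun p q M .x .u) := by
    intro b
    rw [dirD_genFun (by simp), Finset.mul_sum]
    -- Permuting the inputs does not change generating functions, so b may be moved to the last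
    -- factor.
    have step : ∀ a ∈ Finset.univ.erase b,
        genFun p q (capped (Theta p q k) (ThetaLow p q k) (ThetaUp p q k)
          (extend (Theta p q k) M) (Fin.last j) a b) .x .u =
        genFun p q (capped (Theta p q k) (ThetaLow p q k) (ThetaUp p q k)
          (extend (Theta p q k) M) (Fin.last j) (Equiv.swap b (Fin.last j) a) (Fin.last j))
            .x .u := by
      intro a ha
      have hab := Finset.ne_of_mem_erase ha
      rw [← genFun_mul_dperm (capped_unit H hab) (Equiv.swap b (Fin.last j)),
        capped_dperm H hY (swap_fixed (hB b) (hB (Fin.last j))) (hB a) hab,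
        Equiv.swap_apply_left]
    rw [Finset.sum_congr rfl step]
    have : (Finset.univ : Finset (Fin j)).map Fin.castSuccEmb =
        Finset.univ.erase (Fin.last j) := by
      ext m
      induction m using Fin.lastCases with
      | last => simp
      | cast i => simp [(Fin.castSucc_lt_last i).ne]
    rw [Finset.sum_equiv (t := Finset.univ.erase (Fin.last j))
      (g := fun a => genFun p q (capped (Theta p q k) (ThetaLow p q k) (ThetaUp p q k)
          (extend (Theta p q k) M) (Fin.last j) a (Fin.last j)) .x .u)
      (Equiv.swap b (Fin.last j)) ?_ (fun a _ => rfl), ← this, Finset.sum_map]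
    · refine Finset.sum_congr rfl fun s _ => ?_
      rw [← genFun_extend_contr hk hM, capped, moved, mul_assoc]
      have hs : s.castSucc ≠ Fin.last j := (Fin.castSucc_lt_last s).ne
      change genFun p q (_ * (dperm _ (Equiv.swap s.castSucc _) * contrOp _ _ _ _ s.castSucc _))
        _ _ = _
      -- The exchange contained in `moved` is absorbed by the contraction of the same two factors.
      rw [swap_contr H hs]
    · intro a
      simp only [Finset.mem_erase, Finset.mem_univ, and_true, ne_eq]
      rw [← (Equiv.swap b (Fin.last j)).injective.eq_iff (b := b), Equiv.swap_apply_left]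
  have c2 : ∀ m, genFun p q (moved (Theta p q k) (extend (Theta p q k) M) (Fin.last j) m) .x .u =
      form p q k .x .u * genFun p q M .x .u := by
    intro m
    rw [moved, genFun_mul_dperm hY.unit, genFun_extend]
  simp only [id] at hf
  rw [hf, genFun_sub, genFun_smul, genFun_sum, genFun_sum]
  simp only [genFun_sum, c1, c2, Finset.sum_const, Finset.card_univ, Fintype.card_fin,
    ← Nat.cast_smul_eq_nsmul ℂ]
  push_cast
  rw [smul_sub, smul_comm]

end GenFun

/-! ### The closed form of the generating function -/

section ClosedForm
variable {p q : ℕ} {k : Fin (p + q) → ℝ}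

/-- The coefficient `a^(j)_A`, continued by zero to `A > j / 2`. -/
noncomputable def bfCoeff' (D j A : ℕ) : ℂ := if 2 * A ≤ j then bfCoeff D j A else 0

theorem bfCoeff'_zero (D j : ℕ) : bfCoeff' D j 0 = 1 := by
  simp [bfCoeff', bfCoeff, Nat.factorial_ne_zero]

/-- Raising j by 1 shifts s by 1 in each factor, so only a new first factor appears. -/
theorem bf_prod_succ (D j A : ℕ) :
    ∏ s ∈ Finset.Icc 1 (A + 1), (2 * ((j + 1 : ℕ) : ℂ) + (D : ℂ) - 2 * (s : ℂ) - 3) =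
      (2 * (j : ℂ) + D - 3) *
        ∏ s ∈ Finset.Icc 1 A, (2 * (j : ℂ) + (D : ℂ) - 2 * (s : ℂ) - 3) := by
  induction A with
  | zero => simp; ring
  | succ A ih =>
    rw [Finset.prod_Icc_succ_top (by omega), ih, Finset.prod_Icc_succ_top (by omega)]
    push_cast; ring

/-- For 1 ≤ s ≤ A and 2A ≤ j one has 2j - 2s ≥ 2, so with D ≥ 2 every factor is a positive integer.
-/
theorem bf_prod_ne_zero {D j A : ℕ} (hD : 2 ≤ D) (h : 2 * A ≤ j) :
    ∏ s ∈ Finset.Icc 1 A, (2 * (j : ℂ) + (D : ℂ) - 2 * (s : ℂ) - 3) ≠ 0 := by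
  refine Finset.prod_ne_zero_iff.2 fun s hs => ?_
  rw [Finset.mem_Icc] at hs
  have : 2 * (j : ℂ) + (D : ℂ) - 2 * (s : ℂ) - 3 = ((2 * (j : ℤ) + D - 2 * s - 3 : ℤ) : ℂ) := by
    push_cast; ring
  rw [this]
  exact Int.cast_ne_zero.2 (by omega)

/-- This compares coefficients in the recursion for generating functions: the first term collects
Θ^(x)_(u) and the derivative of Θ^(x)_(x), the second the derivative of the power of Θ^(x)_(u). -/
theorem bfCoeff'_succ {D : ℕ} (hD : 2 ≤ D) (j A : ℕ) :
    bfCoeff' D (j + 1) (A + 1) =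
      bfCoeff' D j (A + 1) * (1 - 2 * (1 / (2 * (j : ℂ) + D - 3)) * ((A : ℂ) + 1)) -
        1 / (2 * (j : ℂ) + D - 3) * ((j : ℂ) - 2 * A) * bfCoeff' D j A := by
  rcases lt_trichotomy (2 * A + 1) j with h | h | h
  · obtain ⟨f, rfl⟩ : ∃ f, j = 2 * A + 2 + f := ⟨j - (2 * A + 2), by omega⟩
    have n1 : 2 * ((2 * A + 2 + f : ℕ) : ℂ) + D - 3 ≠ 0 := by
      have : 2 * ((2 * A + 2 + f : ℕ) : ℂ) + D - 3 =
        ((2 * ((2 * A + 2 + f : ℕ) : ℤ) + D - 3 : ℤ) : ℂ) := by push_cast; ring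
      rw [this]; exact Int.cast_ne_zero.2 (by push_cast; omega)
    have n2 : 2 * ((2 * A + 2 + f : ℕ) : ℂ) + D - 2 * ((A + 1 : ℕ) : ℂ) - 3 ≠ 0 := by
      have : 2 * ((2 * A + 2 + f : ℕ) : ℂ) + D - 2 * ((A + 1 : ℕ) : ℂ) - 3 =
        ((2 * ((2 * A + 2 + f : ℕ) : ℤ) + D - 2 * (A + 1) - 3 : ℤ) : ℂ) := by push_cast; ring
      rw [this]; exact Int.cast_ne_zero.2 (by push_cast; omega)
    have n3 := bf_prod_ne_zero (D := D) (j := 2 * A + 2 + f) (A := A) hD (by omega)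
    simp only [bfCoeff', bfCoeff, if_pos (show 2 * (A + 1) ≤ 2 * A + 2 + f + 1 by omega),
      if_pos (show 2 * (A + 1) ≤ 2 * A + 2 + f by omega),
      if_pos (show 2 * A ≤ 2 * A + 2 + f by omega), bf_prod_succ]
    rw [Finset.prod_Icc_succ_top (by omega),
      show 2 * A + 2 + f + 1 - 2 * (A + 1) = f + 1 by omega,
      show 2 * A + 2 + f - 2 * (A + 1) = f by omega,
      show 2 * A + 2 + f - 2 * A = f + 1 + 1 by omega]
    simp only [Nat.factorial_succ (f + 1), Nat.factorial_succ f, Nat.factorial_succ A,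
      Nat.factorial_succ (2 * A + 2 + f)]
    have n4 : (f.factorial : ℂ) ≠ 0 := Nat.cast_ne_zero.2 f.factorial_ne_zero
    have n5 : (A.factorial : ℂ) ≠ 0 := Nat.cast_ne_zero.2 A.factorial_ne_zero
    have n6 : (A : ℂ) + 1 ≠ 0 := Nat.cast_add_one_ne_zero A
    have n7 : (f : ℂ) + 1 ≠ 0 := Nat.cast_add_one_ne_zero f
    have n8 : (f : ℂ) + 1 + 1 ≠ 0 := by exact_mod_cast Nat.succ_ne_zero (f + 1)
    generalize ∏ s ∈ Finset.Icc 1 A,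
      (2 * ((2 * A + 2 + f : ℕ) : ℂ) + (D : ℂ) - 2 * (s : ℂ) - 3) = P at *
    generalize ((2 * A + 2 + f).factorial : ℕ) = F at *
    push_cast at *
    have hxy : 2 * (2 * (A : ℂ) + 2 + f) + D - 2 * ((A : ℂ) + 1) - 3 =
      (2 * (2 * (A : ℂ) + 2 + f) + D - 3) - 2 * ((A : ℂ) + 1) := by ring
    generalize 2 * (2 * (A : ℂ) + 2 + f) + D - 2 * ((A : ℂ) + 1) - 3 = y at *
    generalize 2 * (2 * (A : ℂ) + 2 + f) + D - 3 = x at *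
    rw [pow_succ]
    field_simp
    rw [hxy]
    ring
  -- Here A + 1 is a new top index: the coefficient of rank j at A + 1 is zero by convention.
  · subst h
    have n1 : 2 * ((2 * A + 1 : ℕ) : ℂ) + D - 3 ≠ 0 := by
      have : 2 * ((2 * A + 1 : ℕ) : ℂ) + D - 3 =
        ((2 * ((2 * A + 1 : ℕ) : ℤ) + D - 3 : ℤ) : ℂ) := by push_cast; ring
      rw [this]; exact Int.cast_ne_zero.2 (by push_cast; omega)
    have n3 := bf_prod_ne_zero (D := D) (j := 2 * A + 1) (A := A) hD (by omega)
    simp only [bfCoeff', bfCoeff, if_pos (show 2 * (A + 1) ≤ 2 * A + 1 + 1 by omega),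
      if_neg (show ¬ 2 * (A + 1) ≤ 2 * A + 1 by omega),
      if_pos (show 2 * A ≤ 2 * A + 1 by omega), bf_prod_succ]
    rw [show 2 * A + 1 + 1 - 2 * (A + 1) = 0 by omega, show 2 * A + 1 - 2 * A = 1 by omega]
    simp only [Nat.factorial_zero, Nat.factorial_one, Nat.factorial_succ A,
      Nat.factorial_succ (2 * A + 1)]
    have n5 : (A.factorial : ℂ) ≠ 0 := Nat.cast_ne_zero.2 A.factorial_ne_zero
    have n6 : (A : ℂ) + 1 ≠ 0 := Nat.cast_add_one_ne_zero A
    generalize ∏ s ∈ Finset.Icc 1 A,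
      (2 * ((2 * A + 1 : ℕ) : ℂ) + (D : ℂ) - 2 * (s : ℂ) - 3) = P at *
    generalize ((2 * A + 1).factorial : ℕ) = F at *
    push_cast at *
    rw [pow_succ]
    field_simp
    ring
  -- Every coefficient at A + 1 is zero here; if j = 2A the last term vanishes through its factor j
  -- - 2A.
  · simp only [bfCoeff', if_neg (show ¬ 2 * (A + 1) ≤ j + 1 by omega),
      if_neg (show ¬ 2 * (A + 1) ≤ j by omega)]
    by_cases h2 : 2 * A ≤ j
    · have : j = 2 * A := by omega
      subst this
      push_cast; ring
    · rw [if_neg h2]; ring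

theorem sum_bfCoeff (D j : ℕ) {R : Type*} [AddCommMonoid R] [Module ℂ R] (m : ℕ → R) {N : ℕ}
    (hN : j / 2 + 1 ≤ N) :
    ∑ A ∈ Finset.range (j / 2 + 1), bfCoeff D j A • m A =
      ∑ A ∈ Finset.range N, bfCoeff' D j A • m A := by
  rw [← Finset.sum_subset (Finset.range_subset_range.2 hN)]
  · refine Finset.sum_congr rfl fun A hA => ?_
    rw [bfCoeff', if_pos (by rw [Finset.mem_range] at hA; omega)]
  · intro A _ hA
    rw [bfCoeff', if_neg (by rw [Finset.mem_range] at hA; omega), zero_smul]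

/-- In the application d = u·∂_x, which sends Θ^(x)_(x) to 2Θ^(x)_(u), Θ^(x)_(u) to Θ^(u)_(u), and
Θ^(u)_(u) to 0. The truncated exponent m - 1 is harmless, since its coefficient m is zero when m =
0. -/
theorem derivation_monomial {R : Type*} [CommRing R] [Algebra ℂ R] (d : Derivation ℂ R R)
    {U X T : R} (hU : d U = 0) (hX : d X = (2 : ℂ) • T) (hT : d T = U) (A m : ℕ) :
    X * d ((U * X) ^ A * T ^ m) = (2 * (A : ℂ)) • ((U * X) ^ A * T ^ (m + 1)) +
      (m : ℂ) • ((U * X) ^ (A + 1) * T ^ (m - 1)) := by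
  rw [Derivation.leibniz, Derivation.leibniz_pow, Derivation.leibniz_pow, Derivation.leibniz, hU,
    hX, hT]
  simp only [← Nat.cast_smul_eq_nsmul ℂ, smul_eq_mul, mul_zero, add_zero, mul_smul_comm,
    mul_add, smul_smul]
  rw [add_comm]
  refine congrArg₂ _ ?_ (congrArg _ (by ring))
  cases A with
  | zero => simp
  | succ A =>
    rw [mul_comm ((A + 1 : ℕ) : ℂ) 2]
    refine congrArg _ ?_
    rw [Nat.add_sub_cancel]; ring

theorem form_symm (a b : Letter) : form p q k a b = form p q k b a := by
  simp only [form]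
  rw [Finset.sum_comm]
  refine Finset.sum_congr rfl fun n _ => Finset.sum_congr rfl fun r _ => ?_
  rw [smul_smul, smul_smul, eta_Theta, mul_comm (vec a r), mul_comm (Theta p q k r n)]

theorem dirD_form_ux (k : Fin (p + q) → ℝ) :
    (replaceD .x (vec .u)) (form p q k .x .u) = form p q k .u .u := by
  simp only [form, map_sum, Derivation.map_smul, Derivation.leibniz, replaceD_vec_self,
    replaceD_vec_ne (show Letter.u ≠ Letter.x by simp), mul_zero, zero_add, smul_eq_mul]
  refine Finset.sum_congr rfl fun r _ => Finset.sum_congr rfl fun n _ => ?_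
  rw [mul_comm (vec Letter.u r)]

theorem dirD_form_xx (k : Fin (p + q) → ℝ) :
    (replaceD .x (vec .u)) (form p q k .x .x) = (2 : ℂ) • form p q k .x .u := by
  have e : (replaceD .x (vec .u)) (form p q k .x .x) = form p q k .x .u + form p q k .u .x := by
    simp only [form, map_sum, Derivation.map_smul, Derivation.leibniz, replaceD_vec_self,
      smul_eq_mul, smul_add, Finset.sum_add_distrib]
    simp only [mul_comm (vec Letter.x _) (vec Letter.u _)]
  rw [e, form_symm .u .x, two_smul]

theorem dirD_form_uu (k : Fin (p + q) → ℝ) :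
    (replaceD .x (vec .u)) (form p q k .u .u) = 0 := by
  simp only [form, map_sum, Derivation.map_smul, Derivation.leibniz,
    replaceD_vec_ne (show Letter.u ≠ Letter.x by simp), smul_zero, add_zero,
    Finset.sum_const_zero]

/-- The normalization 1/j! removes the factor j + 1 of `genFun_S_succ`. -/
theorem genFun_XiOp_succ (hD : 2 ≤ p + q) (hk : normSq p q k ≠ 0) (j : ℕ) :
    genFun p q (XiOp p q hk (j + 1)) .x .u =
      form p q k .x .u * genFun p q (XiOp p q hk j) .x .u -
        (1 / (omega p q + 2 * ((j : ℂ) - 1))) • (form p q k .x .x *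
          dirD .u .x (genFun p q (XiOp p q hk j) .x .u)) := by
  have h1 : (j.factorial : ℂ) ≠ 0 := Nat.cast_ne_zero.2 j.factorial_ne_zero
  have h2 : (j : ℂ) + 1 ≠ 0 := Nat.cast_add_one_ne_zero j
  rw [XiOp, XiOp, genFun_smul, genFun_smul, genFun_S_succ hD, smul_smul, map_smul,
    mul_smul_comm, mul_smul_comm, smul_comm _ (1 / (j.factorial : ℂ)), ← smul_sub]
  congr 1
  rw [Nat.factorial_succ]
  push_cast
  field_simp

/-- The induction starts at the empty tensor power, where both sides are 1; the step is the
coefficient recursion, with all sums extended by zero to a common range. -/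
theorem genFun_XiOp (hD : 2 ≤ p + q) (hk : normSq p q k ≠ 0) (j : ℕ) :
    genFun p q (XiOp p q hk j) .x .u = ∑ A ∈ Finset.range (j / 2 + 1),
      bfCoeff (p + q) j A •
        ((form p q k .u .u * form p q k .x .x) ^ A * form p q k .x .u ^ (j - 2 * A)) := by
  induction j with
  | zero =>
    have e : S p q hk 0 (Xi (omega p q) 0) = unitOp 0 (Theta p q k) := rep_one _
    rw [XiOp, e]
    simp [genFun, bfCoeff, unitOp]
  | succ j ih =>
    rw [genFun_XiOp_succ hD, ih, sum_bfCoeff _ _ _ (show (j + 1) / 2 + 1 ≤ j + 2 by omega),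
      dirD_eq, Derivation.coeFn_coe]
    have hc : 1 / (omega p q + 2 * ((j : ℂ) - 1)) =
        1 / (2 * (j : ℂ) + ((p + q : ℕ) : ℂ) - 3) := by
      congr 1; rw [omega]; ring
    rw [hc]
    set c := 1 / (2 * (j : ℂ) + ((p + q : ℕ) : ℂ) - 3) with hcdef
    set U := form p q k .u .u
    set X := form p q k .x .x
    set T := form p q k .x .u
    have hE := derivation_monomial (replaceD .x (vec .u)) (dirD_form_uu k) (dirD_form_xx k)
      (dirD_form_ux k)
    let m : ℕ → Poly (p + q) := fun A => (U * X) ^ A * T ^ (j + 1 - 2 * A)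
    -- For 2A > j the truncated exponents do not match, but the coefficient is zero.
    have h1 : ∀ A, bfCoeff' (p + q) j A • (T * ((U * X) ^ A * T ^ (j - 2 * A))) =
        bfCoeff' (p + q) j A • m A := by
      intro A
      by_cases h : 2 * A ≤ j
      · congr 1
        simp only [m]
        rw [show j + 1 - 2 * A = j - 2 * A + 1 by omega]; ring
      · rw [bfCoeff', if_neg h, zero_smul, zero_smul]
    have h2 : ∀ A, bfCoeff' (p + q) j A •
        (X * replaceD .x (vec .u) ((U * X) ^ A * T ^ (j - 2 * A))) =
        (bfCoeff' (p + q) j A * (2 * (A : ℂ))) • m A +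
          (((j : ℂ) - 2 * A) * bfCoeff' (p + q) j A) • m (A + 1) := by
      intro A
      by_cases h : 2 * A ≤ j
      · rw [hE, smul_add, smul_smul, smul_smul, Nat.cast_sub h]
        simp only [m]
        rw [show j + 1 - 2 * A = j - 2 * A + 1 by omega,
          show j + 1 - 2 * (A + 1) = j - 2 * A - 1 by omega]
        push_cast
        rw [mul_comm ((j : ℂ) - 2 * A)]
      · rw [bfCoeff', if_neg h]; simp
    -- It drops the top term, so that both parts of the derivative become sums over the shifted
    -- index A + 1.
    have h3 : bfCoeff' (p + q) j (j + 1) = 0 := by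
      rw [bfCoeff', if_neg (by omega)]
    have eT : T * ∑ A ∈ Finset.range (j / 2 + 1), bfCoeff (p + q) j A •
        ((U * X) ^ A * T ^ (j - 2 * A)) =
        ∑ A ∈ Finset.range (j + 1), bfCoeff' (p + q) j (A + 1) • m (A + 1) + m 0 := by
      rw [sum_bfCoeff _ _ _ (show j / 2 + 1 ≤ j + 2 by omega), Finset.mul_sum]
      simp only [mul_smul_comm, h1]
      rw [Finset.sum_range_succ', bfCoeff'_zero, one_smul]
    have eX : X * replaceD .x (vec .u) (∑ A ∈ Finset.range (j / 2 + 1), bfCoeff (p + q) j A •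
        ((U * X) ^ A * T ^ (j - 2 * A))) =
        ∑ A ∈ Finset.range (j + 1), (bfCoeff' (p + q) j (A + 1) * (2 * ((A : ℂ) + 1))) • m (A + 1)
        + ∑ A ∈ Finset.range (j + 1),
          (((j : ℂ) - 2 * A) * bfCoeff' (p + q) j A) • m (A + 1) := by
      rw [sum_bfCoeff _ _ _ (show j / 2 + 1 ≤ j + 2 by omega), map_sum, Finset.mul_sum]
      simp only [Derivation.map_smul, mul_smul_comm, h2]
      rw [Finset.sum_add_distrib, Finset.sum_range_succ',
        Finset.sum_range_succ (fun A => (((j : ℂ) - 2 * A) * bfCoeff' (p + q) j A) • m (A + 1)),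
        h3]
      simp
    rw [eT, eX]
    change _ = ∑ A ∈ Finset.range (j + 1 + 1), bfCoeff' (p + q) (j + 1) A • m A
    rw [Finset.sum_range_succ' _ (j + 1), bfCoeff'_zero, one_smul]
    rw [smul_add, Finset.smul_sum, Finset.smul_sum, add_sub_right_comm, ← sub_sub,
      ← Finset.sum_sub_distrib, ← Finset.sum_sub_distrib]
    refine congrArg (· + m 0) (Finset.sum_congr rfl fun A _ => ?_)
    rw [bfCoeff'_succ hD, ← hcdef, smul_smul, smul_smul, ← sub_smul, ← sub_smul]
    congr 1; ring

end ClosedForm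

/-! ### The Behrends-Fronsdal projector -/

section Projector
variable {p q j : ℕ} {k : Fin (p + q) → ℝ}

theorem prod_eta_update (n : Fin j → Fin (p + q)) (s : Fin j) (a : Fin (p + q)) :
    (∏ i, (eta p q (Function.update n s a i) : ℂ)) =
      (eta p q a : ℂ) * ∏ i ∈ Finset.univ.erase s, (eta p q (n i) : ℂ) := by
  rw [← Finset.mul_prod_erase _ _ (Finset.mem_univ s), Function.update_self]
  exact congrArg _ (Finset.prod_congr rfl fun i hi => by
    rw [Function.update_of_ne (Finset.ne_of_mem_erase hi)])

theorem prod_eta_update_update (n : Fin j → Fin (p + q)) {s t : Fin j} (h : s ≠ t)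
    (a : Fin (p + q)) :
    (∏ i, (eta p q (Function.update (Function.update n s a) t a i) : ℂ)) =
      ∏ i ∈ Finset.univ \ {s, t}, (eta p q (n i) : ℂ) := by
  rw [prod_split2 h, Function.update_self, Function.update_of_ne h, Function.update_self,
    eta_mul_self', one_mul]
  refine Finset.prod_congr rfl fun i hi => ?_
  simp only [Finset.mem_sdiff, Finset.mem_univ, true_and, Finset.mem_insert,
    Finset.mem_singleton, not_or] at hi
  rw [Function.update_of_ne hi.2, Function.update_of_ne hi.1]

theorem XiOp_unit (hD : 2 ≤ p + q) (hk : normSq p q k ≠ 0) (j : ℕ) :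
    XiOp p q hk j * unitOp j (Theta p q k) = XiOp p q hk j := by
  rw [XiOp, smul_mul_assoc, (rightTraceless_S hD hk j).unit]

theorem isBFProjector_XiOp (hD : 2 ≤ p + q) (hk : normSq p q k ≠ 0) (j : ℕ) :
    IsBFProjector p q k j (XiOp p q hk j) := by
  have hunit := XiOp_unit hD hk j
  have hadj : adj (XiOp p q hk j) = XiOp p q hk j := by
    rw [XiOp, adj_smul, adj_S hD, star_div₀, star_one, star_natCast]
  have herm : ∀ n r, XiOp p q hk j n r = (∏ i, (eta p q (n i) : ℂ)) *
      (∏ i, (eta p q (r i) : ℂ)) * star (XiOp p q hk j r n) := fun n r =>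
    (congrFun (congrFun hadj n) r).symm
  have hsymm : ∀ (s t : Fin j) n r, XiOp p q hk j n (r ∘ Equiv.swap s t) = XiOp p q hk j n r := by
    intro s t n r
    refine apply_comp_perm hunit ?_ n r
    rw [XiOp, smul_mul_assoc,
      (rightTraceless_S hD hk j).perm _ fun x hx => absurd (Set.mem_univ x) hx]
  have htrans : ∀ (s : Fin j) n r,
      ∑ a, (k a : ℂ) * XiOp p q hk j n (Function.update r s a) = 0 := fun s n r =>
    sum_update_transverse hunit (sum_Theta_mul hk) s n r
  have htrace : ∀ (s t : Fin j), s ≠ t → ∀ n r, ∑ a, (eta p q a : ℂ) *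
      XiOp p q hk j n (Function.update (Function.update r s a) t a) = 0 := by
    intro s t hst n r
    obtain ⟨a₀, b₀, h0⟩ := exists_hat_ne_zero (isTriple_Theta p q hk)
      (by simpa using omega_add_ne_zero hD 0)
    refine sum_update_traceless hunit (sum_eta_Theta_Theta hk) h0 hst ?_ n r
    rw [XiOp, smul_mul_assoc, (rightTraceless_S hD hk j).contr _ trivial _ trivial hst, smul_zero]
  have conj_eta : ∀ a, star (eta p q a : ℂ) = (eta p q a : ℂ) := fun a => Complex.conj_ofReal _
  have conj_k : ∀ a, star (k a : ℂ) = (k a : ℂ) := fun a => Complex.conj_ofReal _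
  refine ⟨?_, herm, hsymm, ?_, htrans, ?_, htrace, ?_, genFun_XiOp hD hk j⟩
  · have h1 : (j.factorial : ℂ) ≠ 0 := Nat.cast_ne_zero.2 j.factorial_ne_zero
    rw [XiOp, smul_mul_smul_comm, S_mul_self hD, smul_smul]
    congr 1
    field_simp
  -- The remaining goals concern the upper indices; hermiticity reduces each of them to the
  -- lower-index statement for the conjugate entries.
  · intro s t n r
    have e : ∏ i, (eta p q ((n ∘ Equiv.swap s t) i) : ℂ) = ∏ i, (eta p q (n i) : ℂ) :=
      Equiv.prod_comp (Equiv.swap s t) fun i => (eta p q (n i) : ℂ)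
    rw [herm, hsymm, e, ← herm]
  · intro s n r
    have e : ∀ a, (eta p q a : ℂ) * (k a : ℂ) * XiOp p q hk j (Function.update n s a) r =
        (∏ i ∈ Finset.univ.erase s, (eta p q (n i) : ℂ)) * (∏ i, (eta p q (r i) : ℂ)) *
          star ((k a : ℂ) * XiOp p q hk j r (Function.update n s a)) := by
      intro a
      rw [herm, prod_eta_update, star_mul', conj_k]
      linear_combination (k a : ℂ) * (∏ i ∈ Finset.univ.erase s, (eta p q (n i) : ℂ)) *
        (∏ i, (eta p q (r i) : ℂ)) * star (XiOp p q hk j r (Function.update n s a)) *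
        eta_mul_self' p q a
    rw [Finset.sum_congr rfl fun a _ => e a, ← Finset.mul_sum, ← star_sum, htrans, star_zero,
      mul_zero]
  · intro s t hst n r
    have e : ∀ a, (eta p q a : ℂ) *
        XiOp p q hk j (Function.update (Function.update n s a) t a) r =
        (∏ i ∈ Finset.univ \ {s, t}, (eta p q (n i) : ℂ)) * (∏ i, (eta p q (r i) : ℂ)) *
          star ((eta p q a : ℂ) *
            XiOp p q hk j r (Function.update (Function.update n s a) t a)) := by
      intro a
      rw [herm, prod_eta_update_update n hst, star_mul', conj_eta]
      ring
    rw [Finset.sum_congr rfl fun a _ => e a, ← Finset.mul_sum, ← star_sum, htrace s t hst,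
      star_zero, mul_zero]

end Projector

end BehrendsFronsdal

theorem mainTheorem4 (p q : ℕ) (hD : 2 ≤ p + q) (k : Fin (p + q) → ℝ) (hk : normSq p q k ≠ 0) :
    (∀ j : ℕ, 2 ≤ j →
      genFun p q (XiOp p q hk j) .x .u =
        (1 / ((j - 1).factorial : ℂ)) •
          (LinearMap.mulLeft ℂ (form p q k .x .u) -
            (1 / (omega p q + 2 * ((j : ℂ) - 2))) •
              (LinearMap.mulLeft ℂ (form p q k .x .x) ∘ₗ dirD .u .x))
          ((formD p q k .x .z ^ (j - 1)) (genFun p q (XiOp p q hk (j - 1)) .z .u))) ∧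
    (∀ j : ℕ, 1 ≤ j → IsBFProjector p q k j (XiOp p q hk j)) := by
  refine ⟨fun j hj => ?_, fun j _ => isBFProjector_XiOp hD hk j⟩
  obtain ⟨i, rfl⟩ : ∃ i, j = i + 1 := ⟨j - 1, by omega⟩
  -- The power of Θ^(x)_(∂_z) produces (j-1)! times the generating function in x, which cancels the
  -- prefactor; what remains is the recursion of `genFun_XiOp_succ`.
  rw [Nat.add_sub_cancel, formD_pow_genFun (XiOp_unit hD hk i), map_smul, smul_smul,
    one_div_mul_cancel (Nat.cast_ne_zero.2 i.factorial_ne_zero), one_smul, genFun_XiOp_succ hD,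
    LinearMap.sub_apply, LinearMap.smul_apply, LinearMap.comp_apply, LinearMap.mulLeft_apply,
    LinearMap.mulLeft_apply]
  congr 3
  push_cast
  ring
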